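/- Let $f\in C^\infty(\mathbb R)$ with $f''\ge 0$, let $u_0^0,e^0\in C^\infty(\mathbb R)$ with $e^0>0$, let $x_0\in\mathbb R$, and let $T>0$ be such that $$-\inf_{\xi>x_0}\big[(u_0^0)'(\xi)f''(u_0^0(\xi))\big]<T^{-1},\qquad -\inf_{\xi<x_0}\big[(u_0^0+e^0)'(\xi)f''(u_0^0(\xi)+e^0(\xi))\big]<T^{-1}.$$ Consider the Cauchy problem $u_t+(f(u))_x=0$ in $\Omega=\mathbb R\times(0,T)$ with $u(x,0)=u^{0}(x)$, where $u^0=u_0^0+e^0$ for $x<x_0$ and $u^0=u_0^0$ for $x>x_0$. A *generalized solution* of this problem is a measurable function $u(x,t)$ on $\Omega$, essentially bounded on $\Omega\cap K$ for every compact $K\subset\mathbb R\times[0,T)$, such that $$\int_\Omega\big[u\,\eta_t+f(u)\,\eta_x\big]\,dx\,dt=0\qquad\text{for all }\eta\in C_c^\infty(\Omega),\tag{2*}$$ and $u(\cdot,t)\to u^0$ in $\mathcal D'(\mathbb R)$ as $t\to+0$. Such a $u$ is *piecewise smooth* if there is a set $E$, having finitely many points in each compact subset of $\Omega$, such that near every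 point of $\Omega\setminus E$ either $u$ is $C^1$, or the point lies on a $C^1$ line $x=\gamma(t)$, near the point $u$ is $C^1$ off this line, and $u$ has a limit at the point from each side of the line. It is *stable* if $u(x-0,t)>u(x+0,t)$ at every point of $\Omega$ where these one-sided limits exist and are different. Let $u_0,e\in C^\infty(\mathbb R\times[0,T])$ and $\phi\in C^\infty([0,T])$ satisfy, for $0<t<T$, $$\begin{aligned}&(u_0)_t+(f(u_0))_x=0\quad (x>\phi(t)),\qquad (u_0+e)_t+(f(u_0+e))_x=0\quad (x<\phi(t)),\\ &\frac{d\phi(t)}{dt}=\frac{f(u_0+e)-f(u_0)}{e}\bigg|_{x=\phi(t)},\end{aligned}\tag{20}$$ together with $\phi(0)=x_0$, $u_0(x,0)+e(x,0)=u_0^0(x)+e^0(x)$ for $x<x_0$ and $u_0(x,0)=u_0^0(x)$ for $x>x_0$. Let $H$ be the Heaviside function. Then $u^*(x,t)=u_0(x,t)+e(x,t)H(-x+\phi(t))$ is a generalized solution of the Cauchy problem (in particular it satisfies (2*)), and it is piecewise smooth and stable. It is the unique one: every piecewise smooth, stable generalized solution of the same Cauchy problem coincides with $u^*$ almost everywhere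 in $\Omega$. -/

import Mathlib

open Set Filter Topology MeasureTheory
open scoped ContDiff

noncomputable section

namespace ShockWave

/-- The open strip `ℝ × (0, T)` of points `(x, t)`. -/
def strip (T : ℝ) : Set (ℝ × ℝ) := univ ×ˢ Ioo 0 T

/-- The Heaviside function; its value at the single point `0` plays no role. -/
def heaviside (ξ : ℝ) : ℝ := if 0 < ξ then 1 else 0

/-- The differential expression `L[u] = u_t + (f(u))_x` at the point `(x, t)`. -/
def lawOp (f : ℝ → ℝ) (u : ℝ → ℝ → ℝ) (x t : ℝ) : ℝ :=
  deriv (fun s => u x s) t + deriv (fun y => f (u y t)) x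

/-- The integral identity: `∫_Ω [u η_t + f(u) η_x] dx dt = 0` for all test functions
`η ∈ 𝒟(Ω)`. -/
def IntegralIdentity (f : ℝ → ℝ) (Ω : Set (ℝ × ℝ)) (u : ℝ → ℝ → ℝ) : Prop :=
  ∀ η : ℝ → ℝ → ℝ, ContDiff ℝ ∞ (Function.uncurry η) →
    HasCompactSupport (Function.uncurry η) → tsupport (Function.uncurry η) ⊆ Ω →
    ∫ p in Ω, (u p.1 p.2 * deriv (fun s => η p.1 s) p.2
      + f (u p.1 p.2) * deriv (fun y => η y p.2) p.1) = 0

/-- `u` is a generalized solution, in the sense of the integral identity, of the Cauchy problem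
`u_t + (f(u))_x = 0` in `ℝ × (0, T)`, `u(x, 0) = g(x)`. Generalized solutions are measurable and
locally bounded in `ℝ × [0, T)` (so that all the integrals below converge), and the initial value
is attained in the sense of distributions in `x`. -/
structure IsGeneralizedSolution (f : ℝ → ℝ) (T : ℝ) (g : ℝ → ℝ) (u : ℝ → ℝ → ℝ) : Prop where
  aestronglyMeasurable :
    AEStronglyMeasurable (Function.uncurry u) (volume.restrict (strip T))
  locallyBounded : ∀ K : Set (ℝ × ℝ), IsCompact K → K ⊆ univ ×ˢ Ico 0 T →
    ∃ M : ℝ, ∀ᵐ p ∂(volume.restrict (strip T)), p ∈ K → |u p.1 p.2| ≤ M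
  integralIdentity : IntegralIdentity f (strip T) u
  initialValue : ∀ ψ : ℝ → ℝ, ContDiff ℝ ∞ ψ → HasCompactSupport ψ →
    Tendsto (fun t => ∫ x, u x t * ψ x) (𝓝[>] 0) (𝓝 (∫ x, g x * ψ x))

/-- `p = (x₁, t₁)` lies on a line `x = γ(t)`, `γ` of class `C¹` near `t₁`, such that `u` is of class
`C¹` near `p` off the line and has a limit at `p` from either side of the line. -/
def IsLinePoint (u : ℝ → ℝ → ℝ) (p : ℝ × ℝ) : Prop :=
  ∃ γ : ℝ → ℝ, ContDiffAt ℝ 1 γ p.2 ∧ γ p.2 = p.1 ∧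
    (∀ᶠ q in 𝓝 p, q.1 ≠ γ q.2 → ContDiffAt ℝ 1 (Function.uncurry u) q) ∧
    (∃ l : ℝ, Tendsto (Function.uncurry u) (𝓝[{q | q.1 < γ q.2}] p) (𝓝 l)) ∧
    (∃ r : ℝ, Tendsto (Function.uncurry u) (𝓝[{q | γ q.2 < q.1}] p) (𝓝 r))

/-- `u` is piecewise smooth in `ℝ × (0, T)`: up to a locally finite set `E` of exceptional points
(where lines begin, end or meet) every point is a point of smoothness or a point of a line across
which `u` or its derivatives may jump. -/
def IsPiecewiseSmooth (T : ℝ) (u : ℝ → ℝ → ℝ) : Prop :=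
  ∃ E : Set (ℝ × ℝ), (∀ K : Set (ℝ × ℝ), IsCompact K → K ⊆ strip T → (E ∩ K).Finite) ∧
    ∀ p ∈ strip T \ E, ContDiffAt ℝ 1 (Function.uncurry u) p ∨ IsLinePoint u p

/-- The stability condition `u(x - 0, t) > u(x + 0, t)` at all points `(x, t)` of `ℝ × (0, T)` at
which the one-sided limits exist and are different. -/
def IsStable (T : ℝ) (u : ℝ → ℝ → ℝ) : Prop :=
  ∀ x t : ℝ, t ∈ Ioo 0 T → ∀ l r : ℝ,
    Tendsto (fun y => u y t) (𝓝[<] x) (𝓝 l) → Tendsto (fun y => u y t) (𝓝[>] x) (𝓝 r) →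
    l ≠ r → r < l

/-- The single shock wave `u₀(x, t) + e(x, t) H(-x + φ(t))`. -/
def shock (u₀ e : ℝ → ℝ → ℝ) (φ : ℝ → ℝ) (x t : ℝ) : ℝ :=
  u₀ x t + e x t * heaviside (-x + φ t)

/-- The initial value: `u₀⁰ + e⁰` to the left of `x₀` and `u₀⁰` to the right. -/
def initialStep (u₀₀ e₀ : ℝ → ℝ) (x₀ x : ℝ) : ℝ :=
  u₀₀ x + e₀ x * heaviside (-x + x₀)

/-- Smooth functions `u₀, e` on `ℝ × [0, T]` and `φ` on `[0, T]` satisfying the system of equations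
that governs the shock wave, with initial data `u₀⁰, e⁰, x₀`. -/
structure SolvesShockSystem (f : ℝ → ℝ) (T : ℝ) (u₀₀ e₀ : ℝ → ℝ) (x₀ : ℝ)
    (u₀ e : ℝ → ℝ → ℝ) (φ : ℝ → ℝ) : Prop where
  smooth_u₀ : ContDiffOn ℝ ∞ (Function.uncurry u₀) (univ ×ˢ Icc 0 T)
  smooth_e : ContDiffOn ℝ ∞ (Function.uncurry e) (univ ×ˢ Icc 0 T)
  smooth_φ : ContDiffOn ℝ ∞ φ (Icc 0 T)
  right_eq : ∀ t ∈ Ioo 0 T, ∀ x, φ t < x → lawOp f u₀ x t = 0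
  left_eq : ∀ t ∈ Ioo 0 T, ∀ x, x < φ t → lawOp f (fun y s => u₀ y s + e y s) x t = 0
  front_eq : ∀ t ∈ Ioo 0 T,
    deriv φ t = (f (u₀ (φ t) t + e (φ t) t) - f (u₀ (φ t) t)) / e (φ t) t
  init_φ : φ 0 = x₀
  init_left : ∀ x, x < x₀ → u₀ x 0 + e x 0 = u₀₀ x + e₀ x
  init_right : ∀ x, x₀ < x → u₀ x 0 = u₀₀ x

end ShockWave

end

/-!
Existence is a matter of verification, uniqueness a comparison of potentials.

**Uniqueness.** A generalized solution `v` makes the form `v dx - f(v) dt` weakly closed, so it has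
a Lipschitz potential `U` (`exists_potential`), formally with `U_x = v` and `U_t + f(U_x) = 0`. Two
solutions with the same initial value have potentials that differ by a constant up to `O(t)`
(`exists_const_potential_sub_tendsto`), and it suffices to show that the potentials of two stable
solutions agree up to this constant for all times.

Since the convex function `f` lies above its tangents, every potential satisfies
`U(x₀, t₀) ≤ U(x₀ - c (t₀ - s), s) + (t₀ - s) f*(c)` along every line of slope `c = f' q`, whether
the solution is stable or not (`IsPotential.fan_le_fan`). For a stable piecewise smooth solution
there are lines with equality, down to every positive time (`exists_fan_le`). Indeed, where the
right-hand side is minimal with respect to the slope, the one-sided states at the foot of the line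
satisfy `f' l ≤ c ≤ f' r` (`deriv_flux_le_of_fan_le`, `le_deriv_flux_of_fan_le`); stability gives
`r ≤ l`, so all three speeds coincide, `f` is affine between the two states, and the line can be
continued backwards (`IsPotential.eventually_fan_le`). The exceptional points of a piecewise smooth
function are met at finitely many times only. The minimum is taken over a compact family of slopes;
at the ends of this family the same inequalities follow from the local bound on the solution
(`IsPotential.exists_lower_edge_gap`, `IsPotential.exists_upper_edge_gap`). Comparing a line
calibrated for one solution with the inequality for the other gives one inequality between the
potentials (`IsPotential.le_sub_const`), and by symmetry equality (`ae_eq_of_stable`).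

**Existence.** The strength of the shock satisfies a linear differential inequality along the front
and therefore stays positive (`SolvesShockSystem.front_pos`), which is stability. For the integral
identity the jump is replaced by a smooth transition across the front: the divergence of the
smoothed solution is bounded by the Rankine–Hugoniot relation
(`SolvesShockSystem.exists_jump_defect_bound`) and tends to zero off the front.
-/

namespace ShockWave

section Potential

variable {f : ℝ → ℝ} {T : ℝ} {g : ℝ → ℝ} {v u : ℝ → ℝ → ℝ} {U V : ℝ × ℝ → ℝ}

/-! ### The potential of a generalized solution -/

/-- `U` is a potential of the closed form `v dx - f(v) dt` on the strip. As `v` is only defined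
almost everywhere, the form cannot be integrated along a given segment; instead the increment of
`U` along a segment is required to be at least `K` as soon as the form, evaluated on the
direction of the segment, is almost everywhere at least `K` in some neighbourhood of it. Upper
bounds follow by exchanging the end points. -/
def IsPotential (f : ℝ → ℝ) (T : ℝ) (v : ℝ → ℝ → ℝ) (U : ℝ × ℝ → ℝ) : Prop :=
  ∀ p ∈ strip T, ∀ p' ∈ strip T, ∀ N : Set (ℝ × ℝ), IsOpen N → segment ℝ p p' ⊆ N → ∀ K : ℝ,
    (∀ᵐ q ∂(volume.restrict (strip T)), q ∈ N →
      K ≤ (p'.1 - p.1) * v q.1 q.2 - (p'.2 - p.2) * f (v q.1 q.2)) →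
    K ≤ U p' - U p

lemma isOpen_strip (T : ℝ) : IsOpen (strip T) := isOpen_univ.prod isOpen_Ioo

lemma convex_strip (T : ℝ) : Convex ℝ (strip T) := convex_univ.prod (convex_Ioo 0 T)

lemma measurableSet_strip (T : ℝ) : MeasurableSet (strip T) := (isOpen_strip T).measurableSet

lemma integrable_indicator_of_bound {g : ℝ × ℝ → ℝ} {K S : Set (ℝ × ℝ)} (hK : IsCompact K)
    (hKS : K ⊆ S) (hg : AEStronglyMeasurable g (volume.restrict S)) {M : ℝ}
    (hM : ∀ᵐ q ∂(volume.restrict S), q ∈ K → |g q| ≤ M) :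
    Integrable (K.indicator g) := by
  rw [integrable_indicator_iff hK.measurableSet]
  have : IsFiniteMeasure (volume.restrict K) := ⟨by simpa using hK.measure_lt_top⟩
  refine Integrable.of_bound (hg.mono_set hKS) M ?_
  have h1 := ae_restrict_of_ae_restrict_of_subset hKS hM
  filter_upwards [h1, ae_restrict_mem hK.measurableSet] with q hq hqK
  exact hq hqK

/-- The linear form `a dx - b dt`. -/
def form (a b : ℝ) : ℝ × ℝ →L[ℝ] ℝ :=
  a • ContinuousLinearMap.fst ℝ ℝ ℝ - b • ContinuousLinearMap.snd ℝ ℝ ℝ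

@[simp] lemma form_apply (a b : ℝ) (d : ℝ × ℝ) : form a b d = a * d.1 - b * d.2 := by
  simp [form]

lemma deriv_test_fst (ρ : ℝ × ℝ → ℝ) (hρ : ContDiff ℝ ∞ ρ) (p : ℝ × ℝ) (x t : ℝ) :
    deriv (fun y => ρ (p - (y, t))) x = - fderiv ℝ ρ (p - (x, t)) (1, 0) := by
  have h1 : HasFDerivAt ρ (fderiv ℝ ρ (p - (x, t))) (p - (x, t)) :=
    (hρ.differentiable (by simp) _).hasFDerivAt
  have h2 : HasDerivAt (fun y : ℝ => p - (y, t)) (-(1, 0)) x := by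
    have := ((hasDerivAt_id x).prodMk (hasDerivAt_const x t)).const_sub p
    simpa using this
  have := h1.comp_hasDerivAt x h2
  rw [map_neg] at this
  exact this.deriv

lemma deriv_test_snd (ρ : ℝ × ℝ → ℝ) (hρ : ContDiff ℝ ∞ ρ) (p : ℝ × ℝ) (x t : ℝ) :
    deriv (fun s => ρ (p - (x, s))) t = - fderiv ℝ ρ (p - (x, t)) (0, 1) := by
  have h1 : HasFDerivAt ρ (fderiv ℝ ρ (p - (x, t))) (p - (x, t)) :=
    (hρ.differentiable (by simp) _).hasFDerivAt
  have h2 : HasDerivAt (fun s : ℝ => p - (x, s)) (-(0, 1)) t := by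
    have := ((hasDerivAt_const t x).prodMk (hasDerivAt_id t)).const_sub p
    simpa using this
  have := h1.comp_hasDerivAt t h2
  rw [map_neg] at this
  exact this.deriv

lemma integrable_kernel_smul {w : ℝ × ℝ → (ℝ × ℝ →L[ℝ] ℝ)} (hwi : Integrable w) {k : ℝ × ℝ → ℝ}
    (hk : Continuous k) (hkc : HasCompactSupport k) (p : ℝ × ℝ) :
    Integrable fun y => k (p - y) • w y :=
  hkc.convolutionExists_right (ContinuousLinearMap.lsmul ℝ ℝ (E := ℝ × ℝ →L[ℝ] ℝ)).flip
    hwi.locallyIntegrable hk p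

/-- The derivative of a mollified form is obtained by differentiating the kernel. -/
lemma exists_mollified_form {w : ℝ × ℝ → (ℝ × ℝ →L[ℝ] ℝ)} (hwi : Integrable w) {ρ : ℝ × ℝ → ℝ}
    (hρs : ContDiff ℝ ∞ ρ) (hρc : HasCompactSupport ρ) :
    ∃ W : ℝ × ℝ → (ℝ × ℝ →L[ℝ] ℝ), Differentiable ℝ W ∧
      (∀ p d, W p d = ∫ y, ρ (p - y) * w y d) ∧
      ∀ p a b, fderiv ℝ W p a b = ∫ y, fderiv ℝ ρ (p - y) a * w y b := by
  let L : (ℝ × ℝ →L[ℝ] ℝ) →L[ℝ] ℝ →L[ℝ] (ℝ × ℝ →L[ℝ] ℝ) :=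
    (ContinuousLinearMap.lsmul ℝ ℝ (E := ℝ × ℝ →L[ℝ] ℝ)).flip
  have hL : ∀ a b, L a b = b • a := fun a b => rfl
  have hWd := fun p => hρc.hasFDerivAt_convolution_right (μ := volume) L hwi.locallyIntegrable
    (hρs.of_le (by simp)) p
  have hconv : ∀ {k : ℝ × ℝ → ℝ}, HasCompactSupport k → Continuous k → ∀ p d,
      convolution w k L volume p d = ∫ y, k (p - y) * w y d := by
    intro k hk hkc p d
    have := integrable_kernel_smul hwi hkc hk p
    rw [convolution_def]
    simp only [hL]
    rw [ContinuousLinearMap.integral_apply this]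
    simp
  refine ⟨convolution w ρ L volume, fun p => (hWd p).differentiableAt,
    hconv hρc hρs.continuous, fun p a b => ?_⟩
  rw [(hWd p).fderiv, convolution_precompR_apply (L := L) hwi.locallyIntegrable
    (hρc.fderiv (𝕜 := ℝ)) (hρs.continuous_fderiv (by simp)), hconv (hρc.fderiv_apply (𝕜 := ℝ) a)
    ((hρs.continuous_fderiv (by simp)).clm_apply continuous_const)]

/-- Mollification at scale `δ` turns `v dx - f(v) dt` into a smooth form `W`. The integral identity,
tested with translates of the mollifier, says that `W` is closed, so `W = dU` by the Poincaré
lemma; and the values of `W` near a segment are averages of those of the original form. -/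
lemma exists_approx_potential (hf : Continuous f) (hv : IsGeneralizedSolution f T g v)
    {δ R : ℝ} (hδ : 0 < δ) :
    ∃ U : ℝ × ℝ → ℝ, ∀ p ∈ Ioo (-R) R ×ˢ Ioo (2 * δ) (T - 2 * δ),
      ∀ p' ∈ Ioo (-R) R ×ˢ Ioo (2 * δ) (T - 2 * δ), ∀ N : Set (ℝ × ℝ),
      (∀ y ∈ segment ℝ p p', Metric.closedBall y δ ⊆ N) → ∀ K : ℝ,
      (∀ᵐ q ∂(volume.restrict (strip T)), q ∈ N →
        K ≤ (p'.1 - p.1) * v q.1 q.2 - (p'.2 - p.2) * f (v q.1 q.2)) →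
      K ≤ U p' - U p := by
  set D : Set (ℝ × ℝ) := Ioo (-R) R ×ˢ Ioo (2 * δ) (T - 2 * δ) with hD
  set B : Set (ℝ × ℝ) := Icc (-R - δ) (R + δ) ×ˢ Icc δ (T - δ) with hB
  have hBc : IsCompact B := isCompact_Icc.prod isCompact_Icc
  have hBs : B ⊆ strip T := by
    rintro ⟨x, t⟩ ⟨-, h1, h2⟩
    exact ⟨mem_univ _, by simp at h1 h2 ⊢; constructor <;> linarith⟩
  have hDB : ∀ p ∈ D, Metric.closedBall p δ ⊆ B := by
    rintro ⟨x, t⟩ ⟨⟨h1, h2⟩, h3, h4⟩ ⟨y, s⟩ hq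
    rw [Metric.mem_closedBall, Prod.dist_eq, max_le_iff, Real.dist_eq, Real.dist_eq, abs_le,
      abs_le] at hq
    simp only at h1 h2 h3 h4 hq
    exact ⟨⟨by simp only; linarith [hq.1.1], by simp only; linarith [hq.1.2]⟩,
      by simp only; linarith [hq.2.1], by simp only; linarith [hq.2.2]⟩
  have hDo : IsOpen D := isOpen_Ioo.prod isOpen_Ioo
  have hDc : Convex ℝ D := (convex_Ioo _ _).prod (convex_Ioo _ _)
  obtain ⟨M, hM⟩ := hv.locallyBounded B hBc (hBs.trans (prod_mono le_rfl Ioo_subset_Ico_self))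
  have hmeas := hv.aestronglyMeasurable
  have hfmeas : AEStronglyMeasurable (fun q : ℝ × ℝ => f (v q.1 q.2)) (volume.restrict (strip T)) :=
    hf.comp_aestronglyMeasurable hmeas
  obtain ⟨C, hC⟩ := (isCompact_Icc (a := -M) (b := M)).exists_bound_of_continuousOn
    hf.continuousOn
  have hVi : Integrable (B.indicator fun q => v q.1 q.2) :=
    integrable_indicator_of_bound hBc hBs hmeas hM
  have hFi : Integrable (B.indicator fun q => f (v q.1 q.2)) := by
    refine integrable_indicator_of_bound hBc hBs hfmeas (M := C) ?_
    filter_upwards [hM] with q hq hqB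
    exact hC _ (abs_le.1 (hq hqB))
  -- the form is cut off outside `B`, which contains all points within `δ` of `D`
  set V := B.indicator fun q : ℝ × ℝ => v q.1 q.2 with hV
  set F := B.indicator fun q : ℝ × ℝ => f (v q.1 q.2) with hF
  set w : ℝ × ℝ → (ℝ × ℝ →L[ℝ] ℝ) := fun q => form (V q) (F q) with hw
  have hwi : Integrable w := by
    simp only [hw, form]
    exact (hVi.smul_const _).sub (hFi.smul_const _)
  let bump : ContDiffBump (0 : ℝ × ℝ) := ⟨δ / 2, δ, by positivity, by linarith⟩
  set ρ : ℝ × ℝ → ℝ := bump.normed volume with hρ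
  have hρs : ContDiff ℝ ∞ ρ := bump.contDiff_normed
  have hρc : HasCompactSupport ρ := bump.hasCompactSupport_normed
  have hρ0 : ∀ x, 0 ≤ ρ x := bump.nonneg_normed
  have hρi : ∫ x, ρ x = 1 := bump.integral_normed
  have hρt : tsupport ρ = Metric.closedBall 0 δ := bump.tsupport_normed_eq
  obtain ⟨W, hWd, hW, hWd'⟩ := exists_mollified_form hwi hρs hρc
  have hkd : ∀ a, HasCompactSupport fun x => fderiv ℝ ρ x a := fun a =>
    hρc.fderiv_apply (𝕜 := ℝ) a
  have hkc : ∀ a, Continuous fun x => fderiv ℝ ρ x a := fun a =>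
    (hρs.continuous_fderiv (by simp)).clm_apply continuous_const
  -- the mollified form is closed: this is the integral identity for `(x, t) ↦ ρ (p - (x, t))`
  have hsymm : ∀ p ∈ D, ∀ a b, fderiv ℝ W p a b = fderiv ℝ W p b a := by
    intro p hp a b
    rw [hWd', hWd', ← sub_eq_zero, ← integral_sub]
    rotate_left
    · have := (integrable_kernel_smul hwi (hkc a) (hkd a) p).apply_continuousLinearMap b
      simpa using this
    · have := (integrable_kernel_smul hwi (hkc b) (hkd b) p).apply_continuousLinearMap a
      simpa using this
    have hid := hv.integralIdentity (fun x t => ρ (p - (x, t)))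
      (hρs.comp (contDiff_const.sub contDiff_id))
      (hρc.comp_homeomorph (Homeomorph.subLeft p)) ?_
    · have hsupp : ∀ y, y ∉ B → ∀ c, fderiv ℝ ρ (p - y) c = 0 := by
        intro y hy c
        have : p - y ∉ tsupport ρ := by
          rw [hρt]
          intro h
          apply hy
          apply hDB p hp
          rw [Metric.mem_closedBall, dist_comm, dist_eq_norm]
          simpa using h
        have h0 := image_eq_zero_of_notMem_tsupport (fun h => this (tsupport_fderiv_subset ℝ h))
        rw [h0]; rfl
      have e1 : ∀ y, fderiv ℝ ρ (p - y) a * w y b - fderiv ℝ ρ (p - y) b * w y a =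
          (a.1 * b.2 - a.2 * b.1) * (strip T).indicator (fun q : ℝ × ℝ =>
            v q.1 q.2 * deriv (fun s => ρ (p - (q.1, s))) q.2
            + f (v q.1 q.2) * deriv (fun y => ρ (p - (y, q.2))) q.1) y := by
        intro y
        by_cases hy : y ∈ B
        · rw [indicator_of_mem (hBs hy), deriv_test_fst ρ hρs, deriv_test_snd ρ hρs]
          have ha : ∀ a : ℝ × ℝ, fderiv ℝ ρ (p - y) a =
              a.1 * fderiv ℝ ρ (p - y) (1, 0) + a.2 * fderiv ℝ ρ (p - y) (0, 1) := by
            intro a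
            conv_lhs => rw [show a = a.1 • ((1 : ℝ), (0 : ℝ)) + a.2 • ((0 : ℝ), (1 : ℝ)) by
              ext <;> simp]
            rw [map_add, map_smul, map_smul]; rfl
          rw [ha a, ha b]
          simp only [hw, form_apply, hV, hF, indicator_of_mem hy]
          ring
        · rw [hsupp y hy, hsupp y hy]
          by_cases hy' : y ∈ strip T
          · rw [indicator_of_mem hy', deriv_test_fst ρ hρs, deriv_test_snd ρ hρs,
              hsupp y hy, hsupp y hy]
            ring
          · rw [indicator_of_notMem hy']; ring
      simp_rw [e1]
      rw [integral_const_mul, integral_indicator (measurableSet_strip T), hid, mul_zero]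
    · intro y hy
      apply hBs
      apply hDB p hp
      have : p - y ∈ tsupport ρ :=
        tsupport_comp_subset_preimage ρ (f := fun y : ℝ × ℝ => p - y) (by fun_prop) hy
      rw [hρt] at this
      rw [Metric.mem_closedBall, dist_comm, dist_eq_norm]
      simpa using this
  obtain ⟨U, hU⟩ := hDc.exists_forall_hasFDerivAt_of_fderiv_symmetric hDo
    (fun p _ => (hWd p).differentiableWithinAt) hsymm
  refine ⟨U, fun p hp p' hp' N hN K hK => ?_⟩
  -- along the segment the derivative is an average of the values of `w`
  have hder : ∀ y ∈ segment ℝ p p', K ≤ W y (p' - p) := by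
    intro y hy
    have hyD : y ∈ D := hDc.segment_subset hp hp' hy
    rw [hW]
    have : K = ∫ q, ρ (y - q) * K := by
      rw [integral_mul_const, integral_sub_left_eq_self (f := ρ), hρi, one_mul]
    rw [this]
    have hK' := (ae_restrict_iff' (measurableSet_strip T)).1 hK
    refine integral_mono_ae ?_ ?_ ?_
    · exact ((hρs.continuous.integrable_of_hasCompactSupport hρc).comp_sub_left y).mul_const K
    · have := (integrable_kernel_smul hwi hρs.continuous hρc y).apply_continuousLinearMap (p' - p)
      simpa using this
    · filter_upwards [hK'] with q hq
      by_cases hqb : q ∈ Metric.closedBall y δ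
      · have hqB := hDB y hyD hqb
        have := hq (hBs hqB) (hN y hy hqb)
        apply mul_le_mul_of_nonneg_left _ (hρ0 _)
        simp only [hw, form_apply, hV, hF, indicator_of_mem hqB]
        simp only [Prod.fst_sub, Prod.snd_sub]
        linarith
      · have : ρ (y - q) = 0 := by
          apply image_eq_zero_of_notMem_tsupport
          rw [hρt]
          intro h
          apply hqb
          rw [Metric.mem_closedBall, dist_comm, dist_eq_norm]
          simpa using h
        simp [this]
  have hline : ∀ s ∈ Icc (0 : ℝ) 1, AffineMap.lineMap p p' s ∈ segment ℝ p p' := by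
    intro s hs
    rw [segment_eq_image_lineMap]
    exact ⟨s, hs, rfl⟩
  have hd : ∀ s ∈ Icc (0 : ℝ) 1, HasDerivAt (fun s : ℝ => U (AffineMap.lineMap p p' s))
      (W (AffineMap.lineMap p p' s) (p' - p)) s := by
    intro s hs
    have h1 := hU _ (hDc.segment_subset hp hp' (hline s hs))
    exact h1.comp_hasDerivAt s AffineMap.hasDerivAt_lineMap
  have := (convex_Icc (0 : ℝ) 1).mul_sub_le_image_sub_of_le_deriv
    (f := fun s : ℝ => U (AffineMap.lineMap p p' s)) (C := K)
    (fun s hs => (hd s hs).continuousAt.continuousWithinAt)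
    (fun s hs => (hd s (interior_subset hs)).differentiableAt.differentiableWithinAt)
    (fun s hs => by
      rw [(hd s (interior_subset hs)).deriv]
      exact hder _ (hline s (interior_subset hs)))
    0 (by simp) 1 (by simp) (by norm_num)
  simpa using this

/-- A continuous flux of a bounded state is bounded. -/
lemma exists_flux_bound (hf : Continuous f) (M : ℝ) : ∃ C, 0 ≤ C ∧ ∀ w, |w| ≤ M → |f w| ≤ C := by
  obtain ⟨C, hC⟩ := (isCompact_Icc (a := -M) (b := M)).exists_bound_of_continuousOn hf.continuousOn
  exact ⟨max C 0, le_max_right _ _, fun w hw => (hC w (abs_le.1 hw)).trans (le_max_left _ _)⟩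

lemma neg_le_mul_sub_mul {a b w z M C : ℝ} (hw : |w| ≤ M) (hz : |z| ≤ C) :
    -(|a| * M + |b| * C) ≤ a * w - b * z := by
  have h1 : |a * w| ≤ |a| * M := by rw [abs_mul]; gcongr
  have h2 : |b * z| ≤ |b| * C := by rw [abs_mul]; gcongr
  linarith [(abs_le.1 h1).1, (abs_le.1 h2).2]

/-- A potential is obtained from the potentials of the mollified forms, normalised at one point.
Their increments are bounded, so they converge along a fixed free ultrafilter; this avoids the
extraction of a locally uniformly convergent subsequence. -/
theorem exists_potential (hT : 0 < T) (hf : Continuous f) (hv : IsGeneralizedSolution f T g v) :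
    ∃ U, IsPotential f T v U := by
  have hδ : ∀ n : ℕ, 0 < T / (8 * (n + 1)) := fun n => by positivity
  choose A hA using fun n : ℕ => exists_approx_potential hf hv (hδ n) (R := n + 1)
  have hδlim : Tendsto (fun n : ℕ => T / (8 * ((n : ℝ) + 1))) atTop (𝓝 0) := by
    have := (tendsto_one_div_add_atTop_nhds_zero_nat (𝕜 := ℝ)).const_mul (T / 8)
    rw [mul_zero] at this
    refine this.congr fun n => ?_
    field_simp
  set b : ℝ × ℝ := (0, T / 2) with hb
  have hbs : b ∈ strip T := ⟨mem_univ _, by simp only [hb]; constructor <;> linarith⟩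
  have hmem : ∀ p ∈ strip T, ∀ᶠ n : ℕ in atTop, p ∈ Ioo (-((n : ℝ) + 1)) (n + 1) ×ˢ
      Ioo (2 * (T / (8 * ((n : ℝ) + 1)))) (T - 2 * (T / (8 * ((n : ℝ) + 1)))) := by
    rintro ⟨x, t⟩ ⟨-, h1, h2⟩
    simp only at h1 h2
    have e1 := hδlim.eventually (gt_mem_nhds (show (0 : ℝ) < t / 2 by linarith))
    have e2 := hδlim.eventually (gt_mem_nhds (show (0 : ℝ) < (T - t) / 2 by linarith))
    have e3 := tendsto_natCast_atTop_atTop (R := ℝ).eventually (eventually_gt_atTop |x|)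
    filter_upwards [e1, e2, e3] with n h1 h2 h3
    rw [abs_lt] at h3
    exact ⟨⟨by simp only; linarith, by simp only; linarith⟩,
      by simp only; linarith, by simp only; linarith⟩
  have hseg : ∀ p ∈ strip T, ∀ p' ∈ strip T, ∀ N : Set (ℝ × ℝ), IsOpen N → segment ℝ p p' ⊆ N →
      ∀ K : ℝ, (∀ᵐ q ∂(volume.restrict (strip T)), q ∈ N →
        K ≤ (p'.1 - p.1) * v q.1 q.2 - (p'.2 - p.2) * f (v q.1 q.2)) →
      ∀ᶠ n in atTop, K ≤ A n p' - A n p := by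
    intro p hp p' hp' N hN hsN K hK
    have hc : IsCompact (segment ℝ p p') := by
      rw [segment_eq_image_lineMap]
      exact isCompact_Icc.image AffineMap.lineMap_continuous
    obtain ⟨ε, hε, hεN⟩ := hc.exists_cthickening_subset_open hN hsN
    filter_upwards [hmem p hp, hmem p' hp', hδlim.eventually (gt_mem_nhds hε)] with n h1 h2 h3
    refine hA n p h1 p' h2 N (fun y hy => ?_) K hK
    refine Subset.trans ?_ hεN
    exact (Metric.closedBall_subset_closedBall h3.le).trans
      (Metric.closedBall_subset_cthickening hy ε)
  have hbound : ∀ p ∈ strip T, ∀ p' ∈ strip T, ∃ C : ℝ, ∀ᶠ n in atTop, -C ≤ A n p' - A n p := by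
    intro p hp p' hp'
    have hc : IsCompact (segment ℝ p p') := by
      rw [segment_eq_image_lineMap]
      exact isCompact_Icc.image AffineMap.lineMap_continuous
    obtain ⟨ε, hε, hεN⟩ := hc.exists_cthickening_subset_open (isOpen_strip T)
      ((convex_strip T).segment_subset hp hp')
    obtain ⟨M, hM⟩ := hv.locallyBounded _ hc.cthickening
      (hεN.trans (prod_mono le_rfl Ioo_subset_Ico_self))
    obtain ⟨C, -, hC⟩ := exists_flux_bound hf M
    refine ⟨|p'.1 - p.1| * M + |p'.2 - p.2| * C, hseg p hp p' hp' _ Metric.isOpen_thickening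
      (Metric.self_subset_thickening hε _) _ ?_⟩
    filter_upwards [hM] with q hq hqN
    have := hq (Metric.thickening_subset_cthickening _ _ hqN)
    exact neg_le_mul_sub_mul this (hC _ this)
  have hlim : ∀ p, ∃ u, p ∈ strip T →
      Tendsto (fun n => A n p - A n b) (hyperfilter ℕ : Filter ℕ) (𝓝 u) := by
    intro p
    by_cases hp : p ∈ strip T
    · obtain ⟨C, hC⟩ := hbound p hp b hbs
      obtain ⟨C', hC'⟩ := hbound b hbs p hp
      have hev : ∀ᶠ n in (hyperfilter ℕ : Filter ℕ), A n p - A n b ∈ Icc (-C') C := by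
        apply Nat.hyperfilter_le_atTop
        filter_upwards [hC, hC'] with n h1 h2
        exact ⟨h2, by linarith⟩
      obtain ⟨u, -, hu⟩ := isCompact_Icc.ultrafilter_le_nhds
        ((hyperfilter ℕ).map fun n => A n p - A n b) (le_principal_iff.2 hev)
      exact ⟨u, fun _ => hu⟩
    · exact ⟨0, fun h => absurd h hp⟩
  choose U hU using hlim
  refine ⟨U, fun p hp p' hp' N hN hsN K hK => ?_⟩
  have h1 := (hU p' hp').sub (hU p hp)
  refine ge_of_tendsto h1 (Nat.hyperfilter_le_atTop ?_)
  filter_upwards [hseg p hp p' hp' N hN hsN K hK] with n hn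
  linarith

lemma IsGeneralizedSolution.exists_bound (hv : IsGeneralizedSolution f T g v) (R : ℝ) {τ : ℝ}
    (hτ : τ < T) : ∃ M, 0 ≤ M ∧ ∀ᵐ q ∂(volume.restrict (strip T)),
      |q.1| ≤ R → q.2 ≤ τ → |v q.1 q.2| ≤ M := by
  obtain ⟨M, hM⟩ := hv.locallyBounded (Icc (-R) R ×ˢ Icc 0 τ) (isCompact_Icc.prod isCompact_Icc)
    (by rintro ⟨x, t⟩ ⟨-, h1, h2⟩; exact ⟨mem_univ _, h1, h2.trans_lt hτ⟩)
  refine ⟨max M 0, le_max_right _ _, ?_⟩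
  filter_upwards [hM, ae_restrict_mem (measurableSet_strip T)] with q hq hqs h1 h2
  exact (hq ⟨abs_le.1 h1, hqs.2.1.le, h2⟩).trans (le_max_left _ _)

lemma IsPotential.neg_le_sub (hU : IsPotential f T v U) {R τ M C : ℝ}
    (hM : ∀ᵐ q ∂(volume.restrict (strip T)), |q.1| ≤ R → q.2 ≤ τ → |v q.1 q.2| ≤ M)
    (hC : ∀ w, |w| ≤ M → |f w| ≤ C) {p p' : ℝ × ℝ} (hp : p ∈ strip T) (hp' : p' ∈ strip T)
    (hpR : |p.1| < R) (hpR' : |p'.1| < R) (hpτ : p.2 < τ) (hpτ' : p'.2 < τ) :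
    -(|p'.1 - p.1| * M + |p'.2 - p.2| * C) ≤ U p' - U p := by
  refine hU p hp p' hp' (Ioo (-R) R ×ˢ Iio τ) (isOpen_Ioo.prod isOpen_Iio)
    (((convex_Ioo _ _).prod (convex_Iio _)).segment_subset ⟨abs_lt.1 hpR, hpτ⟩
      ⟨abs_lt.1 hpR', hpτ'⟩) _ ?_
  filter_upwards [hM] with q hq hqN
  have := hq (abs_le.2 ⟨hqN.1.1.le, hqN.1.2.le⟩) (le_of_lt hqN.2)
  exact neg_le_mul_sub_mul this (hC _ this)

/-- A potential is Lipschitz wherever the solution is bounded. -/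
lemma IsPotential.abs_sub_le (hU : IsPotential f T v U) {R τ M C : ℝ}
    (hM : ∀ᵐ q ∂(volume.restrict (strip T)), |q.1| ≤ R → q.2 ≤ τ → |v q.1 q.2| ≤ M)
    (hC : ∀ w, |w| ≤ M → |f w| ≤ C) {p p' : ℝ × ℝ} (hp : p ∈ strip T) (hp' : p' ∈ strip T)
    (hpR : |p.1| < R) (hpR' : |p'.1| < R) (hpτ : p.2 < τ) (hpτ' : p'.2 < τ) :
    |U p' - U p| ≤ |p'.1 - p.1| * M + |p'.2 - p.2| * C := by
  rw [abs_le]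
  refine ⟨hU.neg_le_sub hM hC hp hp' hpR hpR' hpτ hpτ', ?_⟩
  have := hU.neg_le_sub hM hC hp' hp hpR' hpR hpτ' hpτ
  rw [abs_sub_comm p.1, abs_sub_comm p.2] at this
  linarith

lemma IsPotential.continuousOn (hf : Continuous f) (hv : IsGeneralizedSolution f T g v)
    (hU : IsPotential f T v U) : ContinuousOn U (strip T) := by
  rintro p hp
  obtain ⟨M, -, hM⟩ := hv.exists_bound (|p.1| + 1) (show (p.2 + T) / 2 < T by linarith [hp.2.2])
  obtain ⟨C, -, hC⟩ := exists_flux_bound hf M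
  rw [ContinuousWithinAt, tendsto_iff_dist_tendsto_zero]
  have hlim : Tendsto (fun q : ℝ × ℝ => |q.1 - p.1| * M + |q.2 - p.2| * C) (𝓝[strip T] p)
      (𝓝 0) := by
    have : Continuous fun q : ℝ × ℝ => |q.1 - p.1| * M + |q.2 - p.2| * C := by fun_prop
    have := (this.tendsto p).mono_left (nhdsWithin_le_nhds (s := strip T))
    simpa using this
  refine squeeze_zero' (Eventually.of_forall fun _ => dist_nonneg) ?_ hlim
  have h1 : ∀ᶠ q : ℝ × ℝ in 𝓝 p, |q.1| < |p.1| + 1 :=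
    (continuous_fst.abs.tendsto p).eventually (gt_mem_nhds (by linarith))
  have h2 : ∀ᶠ q : ℝ × ℝ in 𝓝 p, q.2 < (p.2 + T) / 2 :=
    (continuous_snd.tendsto p).eventually (gt_mem_nhds (by linarith [hp.2.2]))
  filter_upwards [nhdsWithin_le_nhds h1, nhdsWithin_le_nhds h2, self_mem_nhdsWithin] with q a b c
  exact hU.abs_sub_le hM hC hp c (by linarith) a (by linarith [hp.2.2]) b

/-- Where the solution is continuous, it is the `x`-derivative of its potential. -/
lemma IsPotential.hasDerivAt (hU : IsPotential f T v U) {x t : ℝ} (ht : t ∈ Ioo 0 T)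
    (hc : ContinuousAt (Function.uncurry v) (x, t)) :
    HasDerivAt (fun y => U (y, t)) (v x t) x := by
  rw [hasDerivAt_iff_isLittleO, Asymptotics.isLittleO_iff]
  intro ε hε
  obtain ⟨δ, hδ, hδv⟩ := Metric.continuousAt_iff.1 hc ε hε
  filter_upwards [Metric.ball_mem_nhds x hδ] with y hy
  have hx0 : (x, t) ∈ Metric.ball (x, t) δ := Metric.mem_ball_self hδ
  have hy0 : (y, t) ∈ Metric.ball (x, t) δ := by
    rw [Metric.mem_ball, Prod.dist_eq]; simpa using hy
  have hmem : ∀ z : ℝ, (z, t) ∈ strip T := fun z => ⟨mem_univ _, ht⟩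
  have hle : ∀ w : ℝ, |w - v x t| < ε → |(y - x) * (w - v x t)| ≤ ε * |y - x| := by
    intro w hw
    rw [abs_mul, mul_comm]; gcongr
  have h1 := hU (x, t) (hmem x) (y, t) (hmem y) _ Metric.isOpen_ball
    ((convex_ball _ _).segment_subset hx0 hy0) ((y - x) * v x t - ε * |y - x|) (by
      refine Eventually.of_forall fun q hq => ?_
      have := hδv hq
      simp only [Function.uncurry, Real.dist_eq] at this
      have := (abs_le.1 (hle _ this)).1
      simp only [sub_self, zero_mul, sub_zero]
      linarith)
  have h2 := hU (y, t) (hmem y) (x, t) (hmem x) _ Metric.isOpen_ball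
    ((convex_ball _ _).segment_subset hy0 hx0) ((x - y) * v x t - ε * |y - x|) (by
      refine Eventually.of_forall fun q hq => ?_
      have := hδv hq
      simp only [Function.uncurry, Real.dist_eq] at this
      have := (abs_le.1 (hle _ this)).2
      simp only [sub_self, zero_mul, sub_zero]
      linarith)
  rw [Real.norm_eq_abs, Real.norm_eq_abs, abs_le, smul_eq_mul]
  constructor <;> linarith

/-! ### Discontinuities of piecewise smooth functions -/

lemma IsLinePoint.eventually_continuousAt {x t : ℝ} (h : IsLinePoint v (x, t)) :
    ∀ᶠ y in 𝓝[≠] x, ContinuousAt (Function.uncurry v) (y, t) := by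
  obtain ⟨γ, -, hγ, hd, -, -⟩ := h
  simp only at hγ
  have : Tendsto (fun y : ℝ => (y, t)) (𝓝[≠] x) (𝓝 (x, t)) :=
    (Continuous.tendsto (by fun_prop) x).mono_left nhdsWithin_le_nhds
  filter_upwards [this.eventually hd, self_mem_nhdsWithin] with y hy hne
  exact (hy (by simpa [hγ] using hne)).continuousAt

lemma IsPiecewiseSmooth.countable_not_continuousAt (hv : IsPiecewiseSmooth T v) {t : ℝ}
    (ht : t ∈ Ioo 0 T) : {x | ¬ ContinuousAt (Function.uncurry v) (x, t)}.Countable := by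
  obtain ⟨E, hE, hreg⟩ := hv
  have hE' : {x | (x, t) ∈ E}.Countable := by
    have : {x | (x, t) ∈ E} ⊆ ⋃ n : ℕ, Prod.fst '' (E ∩ (Icc (-(n : ℝ)) n ×ˢ {t})) := by
      intro x hx
      obtain ⟨n, hn⟩ := exists_nat_ge |x|
      exact mem_iUnion.2 ⟨n, (x, t), ⟨hx, abs_le.1 hn, rfl⟩, rfl⟩
    refine Countable.mono this (countable_iUnion fun n => ?_)
    refine ((hE _ (isCompact_Icc.prod isCompact_singleton) ?_).image _).countable
    rintro ⟨x, s⟩ ⟨-, hs⟩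
    rw [mem_singleton_iff] at hs
    subst hs
    exact ⟨mem_univ _, ht⟩
  -- off `E` every discontinuity is an isolated one within the slice
  set S := {x | ¬ ContinuousAt (Function.uncurry v) (x, t)} with hS
  have hd : (S \ {x | (x, t) ∈ E}).Countable := by
    obtain ⟨s, hs, hsc, hcov⟩ := TopologicalSpace.countable_cover_nhdsWithin
      (f := fun x => {x}) (s := S \ {x | (x, t) ∈ E}) (by
        intro x hx
        have hl : IsLinePoint v (x, t) := by
          rcases hreg (x, t) ⟨⟨mem_univ _, ht⟩, hx.2⟩ with h | h
          · exact absurd h.continuousAt hx.1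
          · exact h
        have := hl.eventually_continuousAt
        rw [eventually_nhdsWithin_iff] at this
        filter_upwards [nhdsWithin_le_nhds this, self_mem_nhdsWithin] with y hy hyS
        by_contra hne
        exact hyS.1 (hy hne))
    refine hsc.mono (hcov.trans ?_)
    simp
  exact (hd.union hE').mono fun x hx => by
    by_cases h : (x, t) ∈ E
    · exact Or.inr h
    · exact Or.inl ⟨hx, h⟩

/-- By Fubini, since every time slice has only countably many discontinuities. -/
lemma IsPiecewiseSmooth.ae_continuousAt (hv : IsPiecewiseSmooth T v) :
    ∀ᵐ p ∂(volume.restrict (strip T)), ContinuousAt (Function.uncurry v) p := by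
  have hm : MeasurableSet {p | ContinuousAt (Function.uncurry v) p} :=
    measurableSet_of_continuousAt _
  rw [ae_restrict_iff' (measurableSet_strip T)]
  have hS : MeasurableSet (strip T ∩ {p | ContinuousAt (Function.uncurry v) p}ᶜ) :=
    (measurableSet_strip T).inter hm.compl
  have : volume (strip T ∩ {p | ContinuousAt (Function.uncurry v) p}ᶜ) = 0 := by
    rw [Measure.volume_eq_prod, Measure.prod_apply_symm hS, lintegral_eq_zero_iff
      (measurable_measure_prodMk_right hS)]
    refine Eventually.of_forall fun t => ?_
    by_cases ht : t ∈ Ioo 0 T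
    · exact ((hv.countable_not_continuousAt ht).mono fun x hx => hx.2).measure_zero _
    · have : (fun x : ℝ => (x, t)) ⁻¹'
          (strip T ∩ {p | ContinuousAt (Function.uncurry v) p}ᶜ) = ∅ :=
        eq_empty_of_forall_notMem fun x hx => ht hx.1.2
      simp [this]
  rw [ae_iff]
  refine measure_mono_null (fun p hp => ?_) this
  simp only [mem_ofPred_eq, Classical.not_imp] at hp
  exact hp

/-! ### The initial trace of the potential -/

lemma IsPotential.continuous_slice (hf : Continuous f) (hv : IsGeneralizedSolution f T g v)
    (hU : IsPotential f T v U) {t : ℝ} (ht : t ∈ Ioo 0 T) : Continuous fun x => U (x, t) := by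
  rw [continuous_iff_continuousAt]
  intro x
  have : ContinuousAt U (x, t) :=
    (hU.continuousOn hf hv).continuousAt ((isOpen_strip T).mem_nhds ⟨mem_univ _, ht⟩)
  exact this.comp (f := fun x : ℝ => (x, t)) (by fun_prop)

/-- Integration by parts in a time slice. The potential is continuous there and differentiable with
derivative `v` off a countable set, which is enough for the fundamental theorem of calculus. -/
lemma IsPotential.integral_mul_deriv (hf : Continuous f) (hv : IsGeneralizedSolution f T g v)
    (hvs : IsPiecewiseSmooth T v) (hU : IsPotential f T v U) {t : ℝ} (ht : t ∈ Ioo 0 T)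
    {ψ : ℝ → ℝ} (hψ : ContDiff ℝ ∞ ψ) (hψc : HasCompactSupport ψ) :
    ∫ x, U (x, t) * deriv ψ x = -∫ x, v x t * ψ x := by
  obtain ⟨R, hR0, hR⟩ : ∃ R > 0, tsupport ψ ⊆ Ioc (-R) R := by
    obtain ⟨R, hR⟩ := hψc.isCompact.isBounded.subset_closedBall 0
    refine ⟨|R| + 1, by positivity, hR.trans fun x hx => ?_⟩
    rw [mem_closedBall_zero_iff, Real.norm_eq_abs] at hx
    have := abs_le.1 (hx.trans (le_abs_self R))
    exact ⟨by linarith, by linarith⟩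
  have hUc := hU.continuous_slice hf hv ht
  have hcount := hvs.countable_not_continuousAt ht
  have hder : ∀ x ∉ {x | ¬ ContinuousAt (Function.uncurry v) (x, t)},
      HasDerivAt (fun y => U (y, t)) (v x t) x := fun x hx => hU.hasDerivAt ht (not_not.1 hx)
  have hψd : ∀ x, HasDerivAt ψ (deriv ψ x) x := fun x =>
    (hψ.differentiable (by simp) x).hasDerivAt
  have hψd' : Continuous (deriv ψ) := hψ.continuous_deriv (by simp)
  obtain ⟨M, hM0, hM⟩ := hv.exists_bound (R + 1) (show (t + T) / 2 < T by linarith [ht.2])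
  obtain ⟨C, -, hC⟩ := exists_flux_bound hf M
  have hae : (fun x => v x t) =ᵐ[volume] deriv fun y => U (y, t) := by
    filter_upwards [hcount.ae_notMem volume] with x hx
    exact (hder x hx).deriv.symm
  have hbd : ∀ᵐ x, x ∈ uIoc (-R) R → ‖v x t‖ ≤ M := by
    filter_upwards [hcount.ae_notMem volume] with x hx hxR
    rw [uIoc_of_le (by linarith)] at hxR
    refine (hder x hx).le_of_lip' hM0 ?_
    filter_upwards [Ioo_mem_nhds (show -(R + 1) < x by linarith [hxR.1])
      (show x < R + 1 by linarith [hxR.2])] with y hy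
    have := hU.abs_sub_le hM hC (p := (x, t)) (p' := (y, t)) ⟨mem_univ _, ht⟩ ⟨mem_univ _, ht⟩
      (abs_lt.2 ⟨by simp only; linarith [hxR.1], by simp only; linarith [hxR.2]⟩)
      (abs_lt.2 ⟨hy.1, hy.2⟩)
      (by simp only; linarith [ht.2]) (by simp only; linarith [ht.2])
    simpa [mul_comm] using this
  have hvi : IntervalIntegrable (fun x => v x t) volume (-R) R := by
    rw [intervalIntegrable_iff]
    have : IsFiniteMeasure (volume.restrict (uIoc (-R) R)) := by
      rw [uIoc]; infer_instance
    refine Integrable.of_bound (C := M) ?_ ?_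
    · exact ((measurable_deriv _).aestronglyMeasurable.congr hae.symm).restrict
    · rw [ae_restrict_iff' measurableSet_uIoc]; exact hbd
  have i1 : IntervalIntegrable (fun x => v x t * ψ x) volume (-R) R :=
    hvi.mul_continuousOn hψ.continuous.continuousOn
  have i2 : IntervalIntegrable (fun x => U (x, t) * deriv ψ x) volume (-R) R :=
    (hUc.mul hψd').intervalIntegrable _ _
  have hmain := MeasureTheory.integral_eq_of_hasDerivAt_off_countable
    (fun x => U (x, t) * ψ x) (fun x => v x t * ψ x + U (x, t) * deriv ψ x) hcount
    (a := -R) (b := R) (hUc.mul hψ.continuous).continuousOn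
    (fun x hx => (hder x hx.2).mul (hψd x)) (i1.add i2)
  have hz : ∀ x, x ∉ Ioc (-R) R → ψ x = 0 := fun x hx =>
    image_eq_zero_of_notMem_tsupport fun h => hx (hR h)
  have hψR : ψ (-R) = 0 := hz _ (by simp)
  have hψR' : ψ R = 0 := by
    by_contra h
    have h1 : ∀ᶠ y in 𝓝 R, ψ y ≠ 0 := hψ.continuous.continuousAt.eventually_ne h
    have h2 : ∀ᶠ y in 𝓝[>] R, ψ y ≠ 0 := nhdsWithin_le_nhds h1
    obtain ⟨y, hy, hyR⟩ := (h2.and self_mem_nhdsWithin).exists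
    exact hy (hz y fun h => absurd h.2 (not_le.2 hyR))
  rw [intervalIntegral.integral_add i1 i2, hψR, hψR', mul_zero, mul_zero, sub_zero] at hmain
  rw [intervalIntegral.integral_eq_integral_of_support_subset (fun x hx => by
      by_contra h; exact hx (by simp [hz x h])),
    intervalIntegral.integral_eq_integral_of_support_subset (fun x hx => by
      by_contra h
      exact hx (by
        have : deriv ψ x = 0 := image_eq_zero_of_notMem_tsupport fun h' =>
          h (hR (tsupport_deriv_subset h'))
        simp [this]))] at hmain
  linarith

/-- A continuous function all of whose weak derivatives vanish is constant. -/
lemma eq_of_integral_mul_deriv_eq_zero {d : ℝ → ℝ} (hd : Continuous d)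
    (h : ∀ ψ : ℝ → ℝ, ContDiff ℝ ∞ ψ → HasCompactSupport ψ → ∫ x, d x * deriv ψ x = 0) (x y : ℝ) :
    d x = d y := by
  let φ : ℕ → ContDiffBump (0 : ℝ) := fun n =>
    ⟨1 / ((n : ℝ) + 1) / 2, 1 / ((n : ℝ) + 1), by positivity, half_lt_self (by positivity)⟩
  have hφ : Tendsto (fun n => (φ n).rOut) atTop (𝓝 0) := tendsto_one_div_add_atTop_nhds_zero_nat
  have hlim : ∀ x, Tendsto (fun n => (convolution ((φ n).normed volume) d
      (ContinuousLinearMap.lsmul ℝ ℝ) volume : ℝ → ℝ) x) atTop (𝓝 (d x)) := fun x =>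
    ContDiffBump.convolution_tendsto_right_of_continuous hφ hd x
  have hconst : ∀ n, (convolution ((φ n).normed volume) d
      (ContinuousLinearMap.lsmul ℝ ℝ) volume : ℝ → ℝ) x = (convolution ((φ n).normed volume) d
      (ContinuousLinearMap.lsmul ℝ ℝ) volume : ℝ → ℝ) y := by
    intro n
    have hs : ContDiff ℝ ∞ ((φ n).normed volume) := (φ n).contDiff_normed
    have hc : HasCompactSupport ((φ n).normed volume) := (φ n).hasCompactSupport_normed
    have hder := fun x => hc.hasDerivAt_convolution_left (ContinuousLinearMap.lsmul ℝ ℝ)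
      (hs.of_le (by simp)) (hd.locallyIntegrable (μ := volume)) x
    refine is_const_of_deriv_eq_zero (fun x => (hder x).differentiableAt) (fun x => ?_) x y
    rw [(hder x).deriv, convolution_eq_swap]
    have := h (fun y => (φ n).normed volume (x - y)) (hs.comp (contDiff_const.sub contDiff_id))
      (hc.comp_homeomorph (Homeomorph.subLeft x))
    rw [← neg_eq_zero, ← integral_neg]
    refine Eq.trans ?_ this
    congr 1
    ext z
    rw [deriv_comp_const_sub]
    simp [mul_comm]
  exact tendsto_nhds_unique ((hlim x).congr hconst) (hlim y)

/-- A Lipschitz function on `(0, τ)` has a limit at `0`, attained at a linear rate. -/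
lemma exists_limit_of_lipschitz {D : ℝ → ℝ} {C τ : ℝ} (hτ : 0 < τ) (hC : 0 ≤ C)
    (h : ∀ s ∈ Ioo 0 τ, ∀ t ∈ Ioo 0 τ, |D t - D s| ≤ C * |t - s|) :
    ∃ d, Tendsto D (𝓝[>] 0) (𝓝 d) ∧ ∀ t ∈ Ioo 0 τ, |D t - d| ≤ C * t := by
  have hl : LipschitzOnWith ⟨C, hC⟩ D (Ioo 0 τ) :=
    LipschitzOnWith.of_dist_le_mul fun x hx y hy => by
      rw [Real.dist_eq, Real.dist_eq]; exact h y hy x hx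
  obtain ⟨G, hG, hGe⟩ := hl.extend_real
  refine ⟨G 0, ?_, fun t ht => ?_⟩
  · refine Tendsto.congr' ?_ ((hG.continuous.tendsto 0).mono_left nhdsWithin_le_nhds)
    filter_upwards [Ioo_mem_nhdsGT hτ] with t ht
    exact (hGe ht).symm
  · have := hG.dist_le_mul t 0
    rw [Real.dist_eq, Real.dist_eq, sub_zero, abs_of_pos ht.1, ← hGe ht] at this
    exact this

/-- The potentials of two solutions with the same initial value differ, up to a constant, by `O(t)`
locally uniformly in `x`. The difference is Lipschitz, hence has a continuous trace at `t = 0`; the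
weak form in which the initial value is attained says that the weak derivative of this trace
vanishes. -/
lemma exists_const_potential_sub_tendsto (hT : 0 < T) (hf : Continuous f)
    (hv : IsGeneralizedSolution f T g v) (hvs : IsPiecewiseSmooth T v) (hV : IsPotential f T v V)
    (hu : IsGeneralizedSolution f T g u) (hus : IsPiecewiseSmooth T u) (hU : IsPotential f T u U) :
    ∃ k : ℝ, ∀ R : ℝ, ∃ C : ℝ, ∀ t ∈ Ioo 0 (T / 2), ∀ x, |x| < R →
      |V (x, t) - U (x, t) - k| ≤ C * t := by
  have hbd : ∀ R : ℝ, ∃ C, 0 ≤ C ∧ ∀ s ∈ Ioo 0 (T / 2), ∀ t ∈ Ioo 0 (T / 2), ∀ x y, |x| < R →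
      |y| < R → |(V (x, t) - U (x, t)) - (V (y, s) - U (y, s))| ≤ C * (|x - y| + |t - s|) := by
    intro R
    obtain ⟨M, hM0, hM⟩ := hv.exists_bound R (show T / 2 < T by linarith)
    obtain ⟨C, hC0, hC⟩ := exists_flux_bound hf M
    obtain ⟨M', hM0', hM'⟩ := hu.exists_bound R (show T / 2 < T by linarith)
    obtain ⟨C', hC0', hC'⟩ := exists_flux_bound hf M'
    refine ⟨M + C + M' + C', by positivity, fun s hs t ht x y hx hy => ?_⟩
    have hms : ∀ z, (z, s) ∈ strip T := fun z => ⟨mem_univ _, hs.1, by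
      simp only; linarith [hs.2]⟩
    have hmt : ∀ z, (z, t) ∈ strip T := fun z => ⟨mem_univ _, ht.1, by
      simp only; linarith [ht.2]⟩
    have h1 := hV.abs_sub_le hM hC (hms y) (hmt x) hy hx hs.2 ht.2
    have h2 := hU.abs_sub_le hM' hC' (hms y) (hmt x) hy hx hs.2 ht.2
    simp only at h1 h2
    have h3 := abs_nonneg (x - y)
    have h4 := abs_nonneg (t - s)
    rw [abs_le] at h1 h2 ⊢
    constructor <;> nlinarith [mul_nonneg h3 hM0, mul_nonneg h3 hM0', mul_nonneg h3 hC0,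
      mul_nonneg h3 hC0', mul_nonneg h4 hM0, mul_nonneg h4 hM0', mul_nonneg h4 hC0,
      mul_nonneg h4 hC0']
  -- `d` is the trace of the difference at `t = 0`
  have hlim : ∀ x : ℝ, ∃ d, Tendsto (fun t => V (x, t) - U (x, t)) (𝓝[>] 0) (𝓝 d) := by
    intro x
    obtain ⟨C, hC0, hC⟩ := hbd (|x| + 1)
    obtain ⟨d, hd, -⟩ := exists_limit_of_lipschitz (D := fun t => V (x, t) - U (x, t))
      (half_pos hT) hC0 (fun s hs t ht => by
        simpa using hC s hs t ht x x (by linarith) (by linarith))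
    exact ⟨d, hd⟩
  choose d hd using hlim
  have hrate : ∀ R : ℝ, ∃ C, 0 ≤ C ∧ ∀ t ∈ Ioo 0 (T / 2), ∀ x, |x| < R →
      |V (x, t) - U (x, t) - d x| ≤ C * t := by
    intro R
    obtain ⟨C, hC0, hC⟩ := hbd R
    refine ⟨C, hC0, fun t ht x hx => ?_⟩
    obtain ⟨d', hd', hr⟩ := exists_limit_of_lipschitz (D := fun t => V (x, t) - U (x, t))
      (half_pos hT) hC0 (fun s hs t ht => by simpa using hC s hs t ht x x hx hx)
    rw [tendsto_nhds_unique (hd x) hd']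
    exact hr t ht
  have hdc : Continuous d := by
    rw [continuous_iff_continuousAt]
    intro x
    obtain ⟨C, hC0, hC⟩ := hbd (|x| + 1)
    have hle : ∀ y, |y| < |x| + 1 → |d y - d x| ≤ C * |y - x| := by
      intro y hy
      refine le_of_tendsto ((hd y).sub (hd x)).abs ?_
      filter_upwards [Ioo_mem_nhdsGT (half_pos hT)] with t ht
      simpa using hC t ht t ht y x hy (by linarith)
    rw [ContinuousAt, tendsto_iff_dist_tendsto_zero]
    refine squeeze_zero' (Eventually.of_forall fun _ => dist_nonneg) (g := fun y => C * |y - x|)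
      ?_ ?_
    · filter_upwards [(continuous_abs.tendsto x).eventually
        (gt_mem_nhds (show |x| < |x| + 1 by linarith))] with y hy
      exact hle y hy
    · have : Continuous fun y => C * |y - x| := by fun_prop
      simpa using this.tendsto x
  refine ⟨d 0, fun R => ?_⟩
  have hconst : ∀ x, d x = d 0 := by
    intro x
    refine eq_of_integral_mul_deriv_eq_zero hdc (fun ψ hψ hψc => ?_) x 0
    have hψd' : Continuous (deriv ψ) := hψ.continuous_deriv (by simp)
    have hψdc : HasCompactSupport (deriv ψ) := hψc.deriv
    obtain ⟨R, hR⟩ : ∃ R, tsupport (deriv ψ) ⊆ Metric.ball 0 R :=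
      hψdc.isCompact.isBounded.subset_ball 0
    obtain ⟨C, hC0, hC⟩ := hrate R
    have l1 : Tendsto (fun t => ∫ x, (V (x, t) - U (x, t)) * deriv ψ x) (𝓝[>] 0)
        (𝓝 (∫ x, d x * deriv ψ x)) := by
      refine tendsto_integral_filter_of_dominated_convergence
        (fun x => (|d x| + C * T) * |deriv ψ x|) ?_ ?_ ?_ ?_
      · filter_upwards [Ioo_mem_nhdsGT hT] with t ht
        exact (((hV.continuous_slice hf hv ht).sub (hU.continuous_slice hf hu ht)).mul
          hψd').aestronglyMeasurable
      · filter_upwards [Ioo_mem_nhdsGT (half_pos hT)] with t ht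
        refine Eventually.of_forall fun x => ?_
        rw [Real.norm_eq_abs, abs_mul]
        by_cases hx : x ∈ tsupport (deriv ψ)
        · gcongr
          have := hC t ht x (by simpa using hR hx)
          have h2 : C * t ≤ C * T := by gcongr; linarith [ht.2]
          have h3 := abs_add_le (V (x, t) - U (x, t) - d x) (d x)
          rw [sub_add_cancel] at h3
          linarith
        · simp [image_eq_zero_of_notMem_tsupport hx]
      · exact (((hdc.abs.add continuous_const).mul hψd'.abs).integrable_of_hasCompactSupport
          (hψdc.abs.mul_left))
      · exact Eventually.of_forall fun x => (hd x).mul_const _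
    have l2 : Tendsto (fun t => ∫ x, (V (x, t) - U (x, t)) * deriv ψ x) (𝓝[>] 0) (𝓝 0) := by
      have := ((hu.initialValue ψ hψ hψc).sub (hv.initialValue ψ hψ hψc))
      rw [sub_self] at this
      refine this.congr' ?_
      filter_upwards [Ioo_mem_nhdsGT hT] with t ht
      have e1 := hV.integral_mul_deriv hf hv hvs ht hψ hψc
      have e2 := hU.integral_mul_deriv hf hu hus ht hψ hψc
      simp_rw [sub_mul]
      rw [integral_sub, e1, e2]
      · ring
      · exact ((hV.continuous_slice hf hv ht).mul hψd').integrable_of_hasCompactSupport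
          hψdc.mul_left
      · exact ((hU.continuous_slice hf hu ht).mul hψd').integrable_of_hasCompactSupport
          hψdc.mul_left
    exact tendsto_nhds_unique l1 l2
  obtain ⟨C, hC0, hC⟩ := hrate R
  refine ⟨C, fun t ht x hx => ?_⟩
  rw [← hconst x]
  exact hC t ht x hx

/-! ### One-sided states -/

lemma ae_fst_ne_of_continuousOn {γ : ℝ → ℝ} {a b : ℝ} (hab : a ≤ b)
    (hγ : ContinuousOn γ (Icc a b)) :
    ∀ᵐ q : ℝ × ℝ, q.2 ∈ Icc a b → q.1 ≠ γ q.2 := by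
  set G : ℝ → ℝ := IccExtend hab ((Icc a b).domRestrict γ) with hG
  have hGc : Continuous G := (continuousOn_iff_continuous_domRestrict.1 hγ).Icc_extend'
  have hS : MeasurableSet {q : ℝ × ℝ | q.1 = G q.2} :=
    (isClosed_eq continuous_fst (hGc.comp continuous_snd)).measurableSet
  have h0 : volume {q : ℝ × ℝ | q.1 = G q.2} = 0 := by
    rw [Measure.volume_eq_prod, Measure.prod_apply_symm hS, lintegral_eq_zero_iff
      (measurable_measure_prodMk_right hS)]
    refine Eventually.of_forall fun t => ?_
    have : (fun x : ℝ => (x, t)) ⁻¹' {q : ℝ × ℝ | q.1 = G q.2} = {G t} := by ext x; simp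
    simp [this]
  filter_upwards [measure_eq_zero_iff_ae_notMem.1 h0] with q hq hqI h
  apply hq
  simp only [hG]
  rw [IccExtend_of_mem hab _ hqI, domRestrict_apply, h]

/-- At a non-exceptional point of a stable piecewise smooth solution there are one-sided states
`r ≤ l`: they are the one-sided `x`-derivatives of the potential, and almost all values of `v` near
the point are close to one of them. At a point of a line, the line itself is negligible. -/
lemma exists_oneSided_states (hst : IsStable T v) (hU : IsPotential f T v U)
    (hf : Continuous f) (hv : IsGeneralizedSolution f T g v) {x t : ℝ} (ht : t ∈ Ioo 0 T)
    (hreg : ContDiffAt ℝ 1 (Function.uncurry v) (x, t) ∨ IsLinePoint v (x, t)) :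
    ∃ l r : ℝ, r ≤ l ∧ HasDerivWithinAt (fun y => U (y, t)) r (Ici x) x ∧
      HasDerivWithinAt (fun y => U (y, t)) l (Iic x) x ∧
      ∀ ε > 0, ∃ δ > 0, ∀ᵐ q : ℝ × ℝ, q ∈ Metric.ball (x, t) δ →
        |v q.1 q.2 - l| < ε ∨ |v q.1 q.2 - r| < ε := by
  rcases hreg with h | h
  · have hc := h.continuousAt
    have hd := hU.hasDerivAt ht hc
    refine ⟨v x t, v x t, le_rfl, hd.hasDerivWithinAt, hd.hasDerivWithinAt, fun ε hε => ?_⟩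
    obtain ⟨δ, hδ, h⟩ := Metric.continuousAt_iff.1 hc ε hε
    exact ⟨δ, hδ, Eventually.of_forall fun q hq => Or.inl (h hq)⟩
  · have hev := h.eventually_continuousAt
    have hUc := hU.continuous_slice hf hv ht
    obtain ⟨γ, hγ, hγx, -, ⟨l, hl⟩, r, hr⟩ := h
    simp only at hγ hγx
    have hder : ∀ᶠ y in 𝓝[≠] x, HasDerivAt (fun y => U (y, t)) (v y t) y :=
      hev.mono fun y hy => hU.hasDerivAt ht hy
    have hl1 : Tendsto (fun y => v y t) (𝓝[<] x) (𝓝 l) := by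
      refine hl.comp (f := fun y : ℝ => (y, t)) (tendsto_nhdsWithin_iff.2 ⟨?_, ?_⟩)
      · exact (Continuous.tendsto (by fun_prop) x).mono_left nhdsWithin_le_nhds
      · filter_upwards [self_mem_nhdsWithin] with y hy
        simpa [hγx] using hy
    have hr1 : Tendsto (fun y => v y t) (𝓝[>] x) (𝓝 r) := by
      refine hr.comp (f := fun y : ℝ => (y, t)) (tendsto_nhdsWithin_iff.2 ⟨?_, ?_⟩)
      · exact (Continuous.tendsto (by fun_prop) x).mono_left nhdsWithin_le_nhds
      · filter_upwards [self_mem_nhdsWithin] with y hy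
        simpa [hγx] using hy
    have hlt : 𝓝[<] x ≤ 𝓝[≠] x := nhdsWithin_mono _ fun y hy => ne_of_lt hy
    have hgt : 𝓝[>] x ≤ 𝓝[≠] x := nhdsWithin_mono _ fun y hy => ne_of_gt hy
    refine ⟨l, r, ?_, ?_, ?_, fun ε hε => ?_⟩
    · by_cases hlr : l = r
      · exact hlr.ge
      · exact (hst x t ht l r hl1 hr1 hlr).le
    · refine hasDerivWithinAt_Ici_of_tendsto_deriv
        (s := {y | HasDerivAt (fun y => U (y, t)) (v y t) y})
        (fun y hy => hy.differentiableAt.differentiableWithinAt)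
        hUc.continuousAt.continuousWithinAt (hgt hder) ?_
      exact hr1.congr' ((hder.filter_mono hgt).mono fun y hy => hy.deriv.symm)
    · refine hasDerivWithinAt_Iic_of_tendsto_deriv
        (s := {y | HasDerivAt (fun y => U (y, t)) (v y t) y})
        (fun y hy => hy.differentiableAt.differentiableWithinAt)
        hUc.continuousAt.continuousWithinAt (hlt hder) ?_
      exact hl1.congr' ((hder.filter_mono hlt).mono fun y hy => hy.deriv.symm)
    · have e1 := eventually_nhdsWithin_iff.1 (hl.eventually (Metric.ball_mem_nhds l hε))
      have e2 := eventually_nhdsWithin_iff.1 (hr.eventually (Metric.ball_mem_nhds r hε))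
      obtain ⟨η, hη, hγc⟩ := Metric.eventually_nhds_iff.1 (hγ.eventually (by simp))
      obtain ⟨δ, hδ, hδe⟩ := Metric.eventually_nhds_iff.1 (e1.and e2)
      have hγc' : ContinuousOn γ (Icc (t - η / 2) (t + η / 2)) := fun s hs =>
        (hγc (by rw [Real.dist_eq, abs_lt]; constructor <;> linarith [hs.1, hs.2])
          ).continuousAt.continuousWithinAt
      refine ⟨min δ (η / 2), by positivity, ?_⟩
      filter_upwards [ae_fst_ne_of_continuousOn (by linarith) hγc'] with q hq hqb
      rw [Metric.mem_ball, lt_min_iff] at hqb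
      have hq2 : dist q.2 t ≤ dist q (x, t) := by rw [Prod.dist_eq]; exact le_max_right _ _
      have hq2' := hq2.trans_lt hqb.2
      rw [Real.dist_eq, abs_lt] at hq2'
      obtain ⟨a1, a2⟩ := hδe hqb.1
      rcases lt_or_gt_of_ne (hq ⟨by linarith, by linarith⟩) with h | h
      · exact Or.inl (a1 h)
      · exact Or.inr (a2 h)

/-! ### Tangent lines of a convex flux -/

lemma tangent_le (hf : Differentiable ℝ f) (hmono : Monotone (deriv f)) (q w : ℝ) :
    f q + deriv f q * (w - q) ≤ f w := by
  rcases lt_trichotomy q w with h | h | h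
  · obtain ⟨c, hc, hc'⟩ := exists_deriv_eq_slope f h hf.continuous.continuousOn
      hf.differentiableOn
    rw [eq_div_iff (by linarith)] at hc'
    nlinarith [mul_le_mul_of_nonneg_right (hmono hc.1.le) (sub_pos.2 h).le]
  · simp [h]
  · obtain ⟨c, hc, hc'⟩ := exists_deriv_eq_slope f h hf.continuous.continuousOn
      hf.differentiableOn
    rw [eq_div_iff (by linarith)] at hc'
    nlinarith [mul_le_mul_of_nonneg_right (hmono hc.2.le) (sub_pos.2 h).le]

/-- The Legendre transform of `f` at the slope `f' q` depends on the slope only. -/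
lemma legendre_eq_of_deriv_eq (hf : Differentiable ℝ f) (hmono : Monotone (deriv f)) {q w : ℝ}
    (h : deriv f q = deriv f w) : deriv f q * q - f q = deriv f w * w - f w := by
  have h1 := tangent_le hf hmono q w
  have h2 := tangent_le hf hmono w q
  rw [h] at h1 ⊢
  linarith

/-- A tangent line of a convex function does not touch the graph where the slope differs. -/
lemma tangent_lt (hf : Differentiable ℝ f) (hmono : Monotone (deriv f)) {q w : ℝ}
    (h : deriv f q ≠ deriv f w) : f q + deriv f q * (w - q) < f w := by
  refine lt_of_le_of_ne (tangent_le hf hmono q w) fun heq => h ?_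
  have hmin : IsLocalMin (fun y => f y - deriv f q * y) w :=
    Eventually.of_forall fun y => by
      have := tangent_le hf hmono q y
      simp only
      linarith
  have hd : HasDerivAt (fun y => f y - deriv f q * y) (deriv f w - deriv f q) w := by
    have := (hf w).hasDerivAt.sub ((hasDerivAt_id w).const_mul (deriv f q))
    rw [mul_one] at this
    exact this
  have := hmin.hasDerivAt_eq_zero hd
  linarith

/-! ### The fan of characteristic lines through a point -/

/-- The value at time `s` on the characteristic line of slope `f' q` through `(x₀, t₀)` of the
potential `U`, increased by the cost `(t₀ - s) f*(f' q)` of the line, where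
`f*(f' q) = q f' q - f q` is the Legendre transform of `f`. By the Fenchel inequality the result
decreases in `s`, and its value at `s = t₀` is `U (x₀, t₀)`; the line is calibrated down to time
`s` when the two values agree. -/
noncomputable def fan (f : ℝ → ℝ) (U : ℝ × ℝ → ℝ) (x₀ t₀ q s : ℝ) : ℝ :=
  U (x₀ - deriv f q * (t₀ - s), s) + (t₀ - s) * (deriv f q * q - f q)

lemma fan_self (x₀ t₀ q : ℝ) : fan f U x₀ t₀ q t₀ = U (x₀, t₀) := by simp [fan]

lemma fan_congr (hf : Differentiable ℝ f) (hmono : Monotone (deriv f)) {q w : ℝ}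
    (h : deriv f q = deriv f w) (x₀ t₀ s : ℝ) : fan f U x₀ t₀ q s = fan f U x₀ t₀ w s := by
  rw [fan, fan, legendre_eq_of_deriv_eq hf hmono h, h]

/-- Every potential is a subsolution: along the line of slope `f' q` the form `v dx - f(v) dt` is at
most `f*(f' q) dt`, because the graph of `f` lies above its tangent at `q`. -/
lemma IsPotential.fan_le_fan (hf : Differentiable ℝ f) (hmono : Monotone (deriv f))
    (hU : IsPotential f T v U) {x₀ t₀ q s s' : ℝ} (hs : 0 < s) (hss : s ≤ s') (hs' : s' < T) :
    fan f U x₀ t₀ q s' ≤ fan f U x₀ t₀ q s := by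
  have := hU (x₀ - deriv f q * (t₀ - s'), s') ⟨mem_univ _, hs.trans_le hss, hs'⟩
    (x₀ - deriv f q * (t₀ - s), s) ⟨mem_univ _, hs, hss.trans_lt hs'⟩ univ isOpen_univ
    (subset_univ _) (-((s' - s) * (deriv f q * q - f q))) (Eventually.of_forall fun p _ => by
      have := tangent_le hf hmono q (v p.1 p.2)
      simp only
      nlinarith [mul_le_mul_of_nonneg_left this (sub_nonneg.2 hss)])
  rw [fan, fan]
  linarith

lemma continuousOn_fan (hf : Differentiable ℝ f) (hf' : Continuous (deriv f))
    (hU : ContinuousOn U (strip T)) (x₀ t₀ : ℝ) :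
    ContinuousOn (fun p : ℝ × ℝ => fan f U x₀ t₀ p.1 p.2) (univ ×ˢ Ioo 0 T) := by
  have hfc := hf.continuous
  unfold fan
  refine ContinuousOn.add (hU.comp (Continuous.continuousOn ?_) ?_) (Continuous.continuousOn ?_)
  · fun_prop
  · rintro ⟨q, s⟩ ⟨-, hs⟩; exact ⟨mem_univ _, hs⟩
  · fun_prop

/-- If the fan at time `s` is minimal at `q` among slightly smaller states, then the characteristic
speed of the state `r` to the right of the foot `z` of the line is at least that of the line: feet
slightly to the right of `z` belong to smaller states `q'`, and minimality bounds the slope of `U`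
to the right of `z` from below by such `q'`. The assumption `hlt` makes sure that there are lines of
smaller slope in the fan. -/
lemma deriv_flux_le_of_fan_le (hf : Differentiable ℝ f) (hf' : Continuous (deriv f))
    (hmono : Monotone (deriv f)) {x₀ t₀ q q₁ s r : ℝ} (hs : s < t₀) (hq : q₁ ≤ q)
    (hlt : deriv f q₁ < deriv f q)
    (hr : HasDerivWithinAt (fun y => U (y, s)) r (Ici (x₀ - deriv f q * (t₀ - s)))
      (x₀ - deriv f q * (t₀ - s)))
    (hmin : ∀ q' ∈ Icc q₁ q, fan f U x₀ t₀ q s ≤ fan f U x₀ t₀ q' s) :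
    deriv f q ≤ deriv f r := by
  by_contra! hc
  set z := x₀ - deriv f q * (t₀ - s) with hz
  have hts : 0 < t₀ - s := sub_pos.2 hs
  -- a slope strictly between, attained by a state larger than `r`
  obtain ⟨c₁, hc₁, hc₁q⟩ := exists_between (max_lt hc hlt)
  rw [max_lt_iff] at hc₁
  obtain ⟨q₀, hq₀, hq₀c⟩ := intermediate_value_Icc hq hf'.continuousOn ⟨hc₁.2.le, hc₁q.le⟩
  have hrq₀ : r < q₀ := by
    by_contra! h
    exact absurd (hmono h) (by rw [hq₀c]; exact not_le.2 hc₁.1)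
  have hslope := (hasDerivWithinAt_iff_tendsto_slope' (by simp)).1 hr.Ioi_of_Ici
  refine absurd (ge_of_tendsto hslope (b := q₀) ?_) (not_le.2 hrq₀)
  have hpos : 0 < (deriv f q - c₁) * (t₀ - s) := mul_pos (by linarith) hts
  filter_upwards [Ioo_mem_nhdsGT (show z < z + (deriv f q - c₁) * (t₀ - s) by linarith)] with y hy
  have hyz : 0 < y - z := sub_pos.2 hy.1
  set c' := deriv f q - (y - z) / (t₀ - s) with hc'
  have hdiv : (y - z) / (t₀ - s) * (t₀ - s) = y - z := div_mul_cancel₀ _ hts.ne'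
  have h1 : c₁ ≤ c' := by
    have : (y - z) / (t₀ - s) ≤ deriv f q - c₁ := by
      rw [div_le_iff₀ hts]; linarith [hy.2]
    linarith
  have h2 : c' ≤ deriv f q := by
    have : 0 ≤ (y - z) / (t₀ - s) := by positivity
    linarith
  obtain ⟨q', hq', hq'c⟩ := intermediate_value_Icc hq₀.2 hf'.continuousOn ⟨hq₀c ▸ h1, h2⟩
  have hm := hmin q' ⟨hq₀.1.trans hq'.1, hq'.2⟩
  have hzy : x₀ - deriv f q' * (t₀ - s) = y := by
    rw [hq'c, hc', sub_mul, hdiv]; linarith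
  rw [fan, fan, hzy, ← hz] at hm
  have ht := tangent_le hf hmono q q'
  have hq'd : deriv f q' * (t₀ - s) = deriv f q * (t₀ - s) - (y - z) := by
    rw [hq'c, hc', sub_mul, hdiv]
  rw [slope_def_field, le_div_iff₀ hyz]
  have h3 : q₀ * (y - z) ≤ q' * (y - z) := mul_le_mul_of_nonneg_right hq'.1 hyz.le
  have h4 : (t₀ - s) * (f q + deriv f q * (q' - q)) ≤ (t₀ - s) * f q' :=
    mul_le_mul_of_nonneg_left ht hts.le
  have h5 : q' * (deriv f q' * (t₀ - s)) = q' * (deriv f q * (t₀ - s) - (y - z)) := by rw [hq'd]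
  nlinarith

/-- The mirror image of `deriv_flux_le_of_fan_le`, for the state to the left of the foot. -/
lemma le_deriv_flux_of_fan_le (hf : Differentiable ℝ f) (hf' : Continuous (deriv f))
    (hmono : Monotone (deriv f)) {x₀ t₀ q q₂ s l : ℝ} (hs : s < t₀) (hq : q ≤ q₂)
    (hlt : deriv f q < deriv f q₂)
    (hl : HasDerivWithinAt (fun y => U (y, s)) l (Iic (x₀ - deriv f q * (t₀ - s)))
      (x₀ - deriv f q * (t₀ - s)))
    (hmin : ∀ q' ∈ Icc q q₂, fan f U x₀ t₀ q s ≤ fan f U x₀ t₀ q' s) :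
    deriv f l ≤ deriv f q := by
  by_contra! hc
  set z := x₀ - deriv f q * (t₀ - s) with hz
  have hts : 0 < t₀ - s := sub_pos.2 hs
  obtain ⟨c₁, hc₁q, hc₁⟩ := exists_between (lt_min hc hlt)
  rw [lt_min_iff] at hc₁
  obtain ⟨q₀, hq₀, hq₀c⟩ := intermediate_value_Icc hq hf'.continuousOn ⟨hc₁q.le, hc₁.2.le⟩
  have hrq₀ : q₀ < l := by
    by_contra! h
    exact absurd (hmono h) (by rw [hq₀c]; exact not_le.2 hc₁.1)
  have hslope := (hasDerivWithinAt_iff_tendsto_slope' (by simp)).1 hl.Iio_of_Iic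
  refine absurd (le_of_tendsto hslope (b := q₀) ?_) (not_le.2 hrq₀)
  have hpos : 0 < (c₁ - deriv f q) * (t₀ - s) := mul_pos (by linarith) hts
  filter_upwards [Ioo_mem_nhdsLT (show z - (c₁ - deriv f q) * (t₀ - s) < z by linarith)] with y hy
  have hyz : 0 < z - y := sub_pos.2 hy.2
  set c' := deriv f q + (z - y) / (t₀ - s) with hc'
  have hdiv : (z - y) / (t₀ - s) * (t₀ - s) = z - y := div_mul_cancel₀ _ hts.ne'
  have h1 : c' ≤ c₁ := by
    have : (z - y) / (t₀ - s) ≤ c₁ - deriv f q := by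
      rw [div_le_iff₀ hts]; linarith [hy.1]
    linarith
  have h2 : deriv f q ≤ c' := by
    have : 0 ≤ (z - y) / (t₀ - s) := by positivity
    linarith
  obtain ⟨q', hq', hq'c⟩ := intermediate_value_Icc hq₀.1 hf'.continuousOn ⟨h2, hq₀c ▸ h1⟩
  have hm := hmin q' ⟨hq'.1, hq'.2.trans hq₀.2⟩
  have hzy : x₀ - deriv f q' * (t₀ - s) = y := by
    rw [hq'c, hc', add_mul, hdiv]; linarith
  rw [fan, fan, hzy, ← hz] at hm
  have ht := tangent_le hf hmono q q'
  have hq'd : deriv f q' * (t₀ - s) = deriv f q * (t₀ - s) + (z - y) := by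
    rw [hq'c, hc', add_mul, hdiv]
  rw [slope_def_field, div_le_iff_of_neg (by linarith)]
  have h3 : q' * (z - y) ≤ q₀ * (z - y) := mul_le_mul_of_nonneg_right hq'.2 hyz.le
  have h4 : (t₀ - s) * (f q + deriv f q * (q' - q)) ≤ (t₀ - s) * f q' :=
    mul_le_mul_of_nonneg_left ht hts.le
  have h5 : q' * (deriv f q' * (t₀ - s)) = q' * (deriv f q * (t₀ - s) + (z - y)) := by rw [hq'd]
  nlinarith

/-- If both one-sided states at a point of a line travel with the speed of the line, then the line
can be continued backwards with an arbitrarily small loss: `f` is affine between the states and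
`q`, so there the Fenchel inequality used in `IsPotential.fan_le_fan` is nearly an equality. -/
lemma IsPotential.eventually_fan_le (hf : Differentiable ℝ f) (hmono : Monotone (deriv f))
    (hU : IsPotential f T v U) {x₀ t₀ q s l r : ℝ} (hs : s ∈ Ioo 0 T)
    (hl : deriv f l = deriv f q) (hr : deriv f r = deriv f q)
    (hlr : ∀ ε > 0, ∃ δ > 0, ∀ᵐ p : ℝ × ℝ,
      p ∈ Metric.ball (x₀ - deriv f q * (t₀ - s), s) δ →
        |v p.1 p.2 - l| < ε ∨ |v p.1 p.2 - r| < ε) {ε : ℝ} (hε : 0 < ε) :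
    ∀ᶠ h in 𝓝[>] 0, fan f U x₀ t₀ q (s - h) ≤ fan f U x₀ t₀ q s + h * ε := by
  set c := deriv f q with hc
  set z := x₀ - c * (t₀ - s) with hz
  have hcont : Continuous fun w => c * w - f w := by have := hf.continuous; fun_prop
  have key : ∀ y, deriv f y = c → ∀ᶠ w in 𝓝 y, c * q - f q - ε ≤ c * w - f w := by
    intro y hy
    have e := legendre_eq_of_deriv_eq hf hmono hy
    rw [hy, ← hc] at e
    rw [← e]
    filter_upwards [(hcont.tendsto y).eventually (lt_mem_nhds (sub_lt_self _ hε))] with w hw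
    exact hw.le
  obtain ⟨η₁, hη₁, h₁⟩ := Metric.eventually_nhds_iff.1 (key l hl)
  obtain ⟨η₂, hη₂, h₂⟩ := Metric.eventually_nhds_iff.1 (key r hr)
  obtain ⟨δ, hδ, hae⟩ := hlr (min η₁ η₂) (lt_min hη₁ hη₂)
  have hsmall : ∀ᶠ h : ℝ in 𝓝[>] 0, (z - h * c, s - h) ∈ Metric.ball (z, s) δ := by
    have : Tendsto (fun h : ℝ => (z - h * c, s - h)) (𝓝[>] 0) (𝓝 (z, s)) := by
      have hcn : Continuous fun h : ℝ => (z - h * c, s - h) := by fun_prop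
      have := (hcn.tendsto 0).mono_left (nhdsWithin_le_nhds (s := Ioi 0))
      simpa using this
    exact this.eventually (Metric.ball_mem_nhds _ hδ)
  filter_upwards [hsmall, Ioo_mem_nhdsGT hs.1] with h hb hh
  have := hU (z - h * c, s - h) ⟨mem_univ _, by simp only; linarith [hh.2],
      by simp only; linarith [hh.1, hs.2]⟩ (z, s) ⟨mem_univ _, hs⟩ _ Metric.isOpen_ball
    ((convex_ball _ _).segment_subset hb (Metric.mem_ball_self hδ)) (h * (c * q - f q - ε)) (by
      refine ae_restrict_of_ae ?_
      filter_upwards [hae] with p hp hpb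
      have : c * q - f q - ε ≤ c * v p.1 p.2 - f (v p.1 p.2) := by
        rcases hp hpb with h | h
        · exact h₁ (h.trans_le (min_le_left _ _))
        · exact h₂ (h.trans_le (min_le_right _ _))
      nlinarith [mul_le_mul_of_nonneg_left this hh.1.le])
  have e1 : x₀ - c * (t₀ - (s - h)) = z - h * c := by rw [hz]; ring
  rw [fan, fan, ← hc, e1, ← hz]
  nlinarith

/-! ### Calibrated lines and uniqueness -/

/-- The lower edge of the fan. Either there are no states slower than `q₁` at all, or `q₁` travels
strictly slower than all states below the local bound. In the second case its line loses a definite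
amount `κ` of energy already while its foot remains in the region where the bound holds. Hence a
foot at which the fan is nearly minimal lies in that region, and the conclusion of
`deriv_flux_le_of_fan_le` holds there because the state `r` obeys the local bound. This replaces a
global bound on the speed of propagation, which is not available. -/
lemma IsPotential.exists_lower_edge_gap (hf : Differentiable ℝ f) (hmono : Monotone (deriv f))
    (hU : IsPotential f T v U) {x₀ t₀ τ M q₁ : ℝ} (ht₀ : 0 < t₀) (htτ : t₀ < τ) (hτ : τ < T)
    (hM : ∀ᵐ q ∂(volume.restrict (strip T)),
      |q.1| ≤ |x₀| + 1 → q.2 ≤ τ → |v q.1 q.2| ≤ M)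
    (hq : deriv f q₁ < deriv f (-M) ∨ ∀ q, deriv f q₁ ≤ deriv f q) :
    ∃ κ > 0, ∀ s ∈ Ioo 0 t₀, ∀ r, HasDerivWithinAt (fun y => U (y, s)) r
      (Ici (x₀ - deriv f q₁ * (t₀ - s))) (x₀ - deriv f q₁ * (t₀ - s)) →
      fan f U x₀ t₀ q₁ s < U (x₀, t₀) + κ → deriv f q₁ ≤ deriv f r := by
  rcases hq with hq | hq
  swap
  · exact ⟨1, one_pos, fun s _ r _ _ => hq r⟩
  obtain ⟨δ, hδ, hδ'⟩ : ∃ δ ∈ Ioo 0 t₀, |deriv f q₁| * δ < 1 := by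
    have h1 : ∀ᶠ δ : ℝ in 𝓝[>] 0, |deriv f q₁| * δ < 1 := by
      have : Tendsto (fun δ : ℝ => |deriv f q₁| * δ) (𝓝 0) (𝓝 0) := by
        have h : Continuous fun δ : ℝ => |deriv f q₁| * δ := by fun_prop
        simpa using h.tendsto 0
      exact nhdsWithin_le_nhds (this.eventually (gt_mem_nhds one_pos))
    exact ((eventually_mem_set.2 (Ioo_mem_nhdsGT ht₀)).and h1).exists
  have hfoot : ∀ s ∈ Ico (t₀ - δ) t₀, |x₀ - deriv f q₁ * (t₀ - s)| < |x₀| + 1 := by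
    intro s hs
    have h1 := abs_sub x₀ (deriv f q₁ * (t₀ - s))
    rw [abs_mul, abs_of_pos (show 0 < t₀ - s by linarith [hs.2])] at h1
    have : |deriv f q₁| * (t₀ - s) ≤ |deriv f q₁| * δ := by gcongr; linarith [hs.1]
    linarith
  -- the edge line loses a definite amount of energy before time `t₀ - δ`
  have hgap : U (x₀, t₀) < fan f U x₀ t₀ q₁ (t₀ - δ) := by
    have hlt := tangent_lt hf hmono hq.ne
    have := hU (x₀, t₀) ⟨mem_univ _, ht₀, htτ.trans hτ⟩
      (x₀ - deriv f q₁ * (t₀ - (t₀ - δ)), t₀ - δ)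
      ⟨mem_univ _, by simp only; linarith [hδ.2], by simp only; linarith [hδ.1]⟩
      (Ioo (-(|x₀| + 1)) (|x₀| + 1) ×ˢ Iio τ) (isOpen_Ioo.prod isOpen_Iio)
      (((convex_Ioo _ _).prod (convex_Iio _)).segment_subset
        ⟨abs_lt.1 (by simp), htτ⟩
        ⟨abs_lt.1 (hfoot _ ⟨le_rfl, by linarith [hδ.1]⟩), by
          rw [mem_Iio]; simp only; linarith [hδ.1]⟩)
      (δ * (f (-M) + deriv f q₁ * M)) (by
        filter_upwards [hM] with p hp hpN
        have hpM := abs_le.1 (hp (abs_le.2 ⟨hpN.1.1.le, hpN.1.2.le⟩) (le_of_lt hpN.2))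
        have h1 := tangent_le hf hmono (-M) (v p.1 p.2)
        have h2 : deriv f q₁ * (v p.1 p.2 - -M) ≤ deriv f (-M) * (v p.1 p.2 - -M) :=
          mul_le_mul_of_nonneg_right hq.le (by linarith [hpM.1])
        have h3 : f (-M) + deriv f q₁ * M ≤ f (v p.1 p.2) - deriv f q₁ * v p.1 p.2 := by
          linarith
        have h4 := mul_le_mul_of_nonneg_left h3 hδ.1.le
        linarith)
    have h5 : 0 < δ * (f (-M) - (f q₁ + deriv f q₁ * (-M - q₁))) :=
      mul_pos hδ.1 (sub_pos.2 hlt)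
    rw [fan]
    have h6 : t₀ - (t₀ - δ) = δ := by ring
    rw [h6] at this ⊢
    linarith
  refine ⟨fan f U x₀ t₀ q₁ (t₀ - δ) - U (x₀, t₀), sub_pos.2 hgap, fun s hs r hr hfan => ?_⟩
  rcases lt_or_ge s (t₀ - δ) with hsδ | hsδ
  · have := hU.fan_le_fan hf hmono (x₀ := x₀) (t₀ := t₀) (q := q₁) hs.1 hsδ.le
      (by linarith [hδ.1])
    linarith
  -- the slope of the potential at the foot is at least `-M`
  · have hz := hfoot s ⟨hsδ, hs.2⟩
    set z := x₀ - deriv f q₁ * (t₀ - s) with hzdef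
    obtain ⟨C, -, hC⟩ := exists_flux_bound hf.continuous M
    have hslope := (hasDerivWithinAt_iff_tendsto_slope' (by simp)).1 hr.Ioi_of_Ici
    have hrM : -M ≤ r := by
      refine ge_of_tendsto hslope ?_
      filter_upwards [Ioo_mem_nhdsGT (abs_lt.1 hz).2] with y hy
      have := hU.abs_sub_le hM hC (p := (z, s)) (p' := (y, s))
        ⟨mem_univ _, hs.1, by simp only; linarith [hs.2]⟩
        ⟨mem_univ _, hs.1, by simp only; linarith [hs.2]⟩ hz
        (abs_lt.2 ⟨(abs_lt.1 hz).1.trans hy.1, hy.2⟩)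
        (by simp only; linarith [hs.2]) (by simp only; linarith [hs.2])
      simp only [sub_self, abs_zero, zero_mul, add_zero] at this
      have hyz : 0 < y - z := sub_pos.2 hy.1
      rw [abs_of_pos hyz] at this
      rw [slope_def_field, le_div_iff₀ hyz]
      linarith [(abs_le.1 this).1]
    exact hq.le.trans (hmono hrM)

/-- The mirror image of `IsPotential.exists_lower_edge_gap` at the upper edge of the fan. -/
lemma IsPotential.exists_upper_edge_gap (hf : Differentiable ℝ f) (hmono : Monotone (deriv f))
    (hU : IsPotential f T v U) {x₀ t₀ τ M q₂ : ℝ} (ht₀ : 0 < t₀) (htτ : t₀ < τ) (hτ : τ < T)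
    (hM : ∀ᵐ q ∂(volume.restrict (strip T)),
      |q.1| ≤ |x₀| + 1 → q.2 ≤ τ → |v q.1 q.2| ≤ M)
    (hq : deriv f M < deriv f q₂ ∨ ∀ q, deriv f q ≤ deriv f q₂) :
    ∃ κ > 0, ∀ s ∈ Ioo 0 t₀, ∀ l, HasDerivWithinAt (fun y => U (y, s)) l
      (Iic (x₀ - deriv f q₂ * (t₀ - s))) (x₀ - deriv f q₂ * (t₀ - s)) →
      fan f U x₀ t₀ q₂ s < U (x₀, t₀) + κ → deriv f l ≤ deriv f q₂ := by
  rcases hq with hq | hq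
  swap
  · exact ⟨1, one_pos, fun s _ r _ _ => hq r⟩
  obtain ⟨δ, hδ, hδ'⟩ : ∃ δ ∈ Ioo 0 t₀, |deriv f q₂| * δ < 1 := by
    have h1 : ∀ᶠ δ : ℝ in 𝓝[>] 0, |deriv f q₂| * δ < 1 := by
      have : Tendsto (fun δ : ℝ => |deriv f q₂| * δ) (𝓝 0) (𝓝 0) := by
        have h : Continuous fun δ : ℝ => |deriv f q₂| * δ := by fun_prop
        simpa using h.tendsto 0
      exact nhdsWithin_le_nhds (this.eventually (gt_mem_nhds one_pos))
    exact ((eventually_mem_set.2 (Ioo_mem_nhdsGT ht₀)).and h1).exists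
  have hfoot : ∀ s ∈ Ico (t₀ - δ) t₀, |x₀ - deriv f q₂ * (t₀ - s)| < |x₀| + 1 := by
    intro s hs
    have h1 := abs_sub x₀ (deriv f q₂ * (t₀ - s))
    rw [abs_mul, abs_of_pos (show 0 < t₀ - s by linarith [hs.2])] at h1
    have : |deriv f q₂| * (t₀ - s) ≤ |deriv f q₂| * δ := by gcongr; linarith [hs.1]
    linarith
  have hgap : U (x₀, t₀) < fan f U x₀ t₀ q₂ (t₀ - δ) := by
    have hlt := tangent_lt hf hmono hq.ne'
    have := hU (x₀, t₀) ⟨mem_univ _, ht₀, htτ.trans hτ⟩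
      (x₀ - deriv f q₂ * (t₀ - (t₀ - δ)), t₀ - δ)
      ⟨mem_univ _, by simp only; linarith [hδ.2], by simp only; linarith [hδ.1]⟩
      (Ioo (-(|x₀| + 1)) (|x₀| + 1) ×ˢ Iio τ) (isOpen_Ioo.prod isOpen_Iio)
      (((convex_Ioo _ _).prod (convex_Iio _)).segment_subset
        ⟨abs_lt.1 (by simp), htτ⟩
        ⟨abs_lt.1 (hfoot _ ⟨le_rfl, by linarith [hδ.1]⟩), by
          rw [mem_Iio]; simp only; linarith [hδ.1]⟩)
      (δ * (f M - deriv f q₂ * M)) (by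
        filter_upwards [hM] with p hp hpN
        have hpM := abs_le.1 (hp (abs_le.2 ⟨hpN.1.1.le, hpN.1.2.le⟩) (le_of_lt hpN.2))
        have h1 := tangent_le hf hmono M (v p.1 p.2)
        have h2 : deriv f M * (M - v p.1 p.2) ≤ deriv f q₂ * (M - v p.1 p.2) :=
          mul_le_mul_of_nonneg_right hq.le (by linarith [hpM.2])
        have h3 : f M - deriv f q₂ * M ≤ f (v p.1 p.2) - deriv f q₂ * v p.1 p.2 := by
          linarith
        have h4 := mul_le_mul_of_nonneg_left h3 hδ.1.le
        linarith)
    have h5 : 0 < δ * (f M - (f q₂ + deriv f q₂ * (M - q₂))) :=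
      mul_pos hδ.1 (sub_pos.2 hlt)
    rw [fan]
    have h6 : t₀ - (t₀ - δ) = δ := by ring
    rw [h6] at this ⊢
    linarith
  refine ⟨fan f U x₀ t₀ q₂ (t₀ - δ) - U (x₀, t₀), sub_pos.2 hgap, fun s hs l hl hfan => ?_⟩
  rcases lt_or_ge s (t₀ - δ) with hsδ | hsδ
  · have := hU.fan_le_fan hf hmono (x₀ := x₀) (t₀ := t₀) (q := q₂) hs.1 hsδ.le
      (by linarith [hδ.1])
    linarith
  · have hz := hfoot s ⟨hsδ, hs.2⟩
    set z := x₀ - deriv f q₂ * (t₀ - s) with hzdef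
    obtain ⟨C, -, hC⟩ := exists_flux_bound hf.continuous M
    have hslope := (hasDerivWithinAt_iff_tendsto_slope' (by simp)).1 hl.Iio_of_Iic
    have hlM : l ≤ M := by
      refine le_of_tendsto hslope ?_
      filter_upwards [Ioo_mem_nhdsLT (abs_lt.1 hz).1] with y hy
      have := hU.abs_sub_le hM hC (p := (z, s)) (p' := (y, s))
        ⟨mem_univ _, hs.1, by simp only; linarith [hs.2]⟩
        ⟨mem_univ _, hs.1, by simp only; linarith [hs.2]⟩ hz
        (abs_lt.2 ⟨hy.1, hy.2.trans (abs_lt.1 hz).2⟩)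
        (by simp only; linarith [hs.2]) (by simp only; linarith [hs.2])
      simp only [sub_self, abs_zero, zero_mul, add_zero] at this
      have hyz : y - z < 0 := sub_neg.2 hy.2
      rw [abs_of_neg hyz] at this
      rw [slope_def_field, div_le_iff_of_neg hyz]
      linarith [(abs_le.1 this).1]
    exact (hmono hlM).trans hq.le

/-- Through every point there is, for every earlier time `a`, a calibrated line down to time `a`,
whose slope belongs to a fixed compact set. Otherwise let `s₀` be the least time down to which some
line is calibrated. Just below `s₀` there are no exceptional points on the fan; minimising there the
fan value with a small penalty on time, one finds a line near whose foot `f' l ≤ f' q ≤ f' r`. By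
stability `r ≤ l`, so the three speeds agree and `IsPotential.eventually_fan_le` continues the line
further back, contradicting minimality. -/
theorem exists_fan_le (hf : Differentiable ℝ f) (hf' : Continuous (deriv f))
    (hmono : Monotone (deriv f)) (hv : IsGeneralizedSolution f T g v)
    (hvs : IsPiecewiseSmooth T v) (hst : IsStable T v) (hU : IsPotential f T v U) {x₀ t₀ : ℝ}
    (ht₀ : t₀ ∈ Ioo 0 T) :
    ∃ q₁ q₂ : ℝ, ∀ a ∈ Ioc 0 t₀, ∃ q ∈ Icc q₁ q₂, fan f U x₀ t₀ q a ≤ U (x₀, t₀) := by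
  obtain ⟨τ, hτ₀, hτ⟩ := exists_between ht₀.2
  obtain ⟨M, hM0, hM⟩ := hv.exists_bound (|x₀| + 1) hτ
  -- the edges of the fan: strictly slower and faster than the states below the bound `M`, if
  -- there are such states at all
  obtain ⟨q₁, hq₁M, hq₁⟩ : ∃ q₁ ≤ -M, deriv f q₁ < deriv f (-M) ∨
      ∀ q, deriv f q₁ ≤ deriv f q := by
    by_cases h : ∃ q ≤ -M, deriv f q < deriv f (-M)
    · obtain ⟨q, h1, h2⟩ := h; exact ⟨q, h1, Or.inl h2⟩
    · push Not at h
      exact ⟨-M, le_rfl, Or.inr fun q => (le_total q (-M)).elim (h q) fun h' => hmono h'⟩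
  obtain ⟨q₂, hq₂M, hq₂⟩ : ∃ q₂ ≥ M, deriv f M < deriv f q₂ ∨
      ∀ q, deriv f q ≤ deriv f q₂ := by
    by_cases h : ∃ q ≥ M, deriv f M < deriv f q
    · obtain ⟨q, h1, h2⟩ := h; exact ⟨q, h1, Or.inl h2⟩
    · push Not at h
      exact ⟨M, le_rfl, Or.inr fun q => (le_total M q).elim (h q) fun h' => hmono h'⟩
  have hq₁₂ : q₁ ≤ q₂ := by linarith
  obtain ⟨κ₁, hκ₁, hedge₁⟩ := hU.exists_lower_edge_gap hf hmono ht₀.1 hτ₀ hτ hM hq₁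
  obtain ⟨κ₂, hκ₂, hedge₂⟩ := hU.exists_upper_edge_gap hf hmono ht₀.1 hτ₀ hτ hM hq₂
  refine ⟨q₁, q₂, fun a ha => ?_⟩
  obtain ⟨E, hE, hreg⟩ := hvs
  have hfc := continuousOn_fan hf hf' (hU.continuousOn hf.continuous hv) x₀ t₀
  set I := Icc q₁ q₂ with hI
  have hIne : I.Nonempty := ⟨q₁, le_rfl, hq₁₂⟩
  have hcpt : IsCompact (I ×ˢ Icc a t₀) := isCompact_Icc.prod isCompact_Icc
  have hsub : I ×ˢ Icc a t₀ ⊆ univ ×ˢ Ioo 0 T := by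
    rintro ⟨q, s⟩ ⟨-, h1, h2⟩
    exact ⟨mem_univ _, ha.1.trans_le h1, h2.trans_lt ht₀.2⟩
  -- the exceptional times
  obtain ⟨S, hS, hSE⟩ : ∃ S : Set ℝ, S.Finite ∧ ∀ q ∈ I, ∀ s ∈ Icc a t₀, s ∉ S →
      (x₀ - deriv f q * (t₀ - s), s) ∉ E := by
    have hmap : Continuous fun p : ℝ × ℝ => (x₀ - deriv f p.1 * (t₀ - p.2), p.2) := by fun_prop
    have hfin := hE _ (hcpt.image hmap) (by
      rintro _ ⟨⟨q, s⟩, hp, rfl⟩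
      exact ⟨mem_univ _, (hsub hp).2⟩)
    refine ⟨_, hfin.image Prod.snd, fun q hq s hs hsS hmem => hsS ?_⟩
    exact ⟨_, ⟨hmem, (q, s), ⟨hq, hs⟩, rfl⟩, rfl⟩
  -- the least time down to which a calibrated line exists
  have hA : IsCompact (Prod.snd '' ((I ×ˢ Icc a t₀) ∩
      (fun p : ℝ × ℝ => fan f U x₀ t₀ p.1 p.2) ⁻¹' Iic (U (x₀, t₀)))) := by
    refine IsCompact.image ?_ continuous_snd
    exact hcpt.of_isClosed_subset
      ((hfc.mono hsub).preimage_isClosed_of_isClosed hcpt.isClosed isClosed_Iic) inter_subset_left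
  obtain ⟨s₀, ⟨⟨q₀, s₀'⟩, ⟨⟨hq₀, hs₀⟩, hfan₀⟩, rfl⟩, hleast⟩ := hA.exists_isLeast
    ⟨t₀, (q₁, t₀), ⟨⟨⟨le_rfl, hq₁₂⟩, ha.2, le_rfl⟩, (fan_self x₀ t₀ q₁).le⟩, rfl⟩
  simp only at hs₀ hq₀ hfan₀ hleast
  rcases hs₀.1.eq_or_lt with h | has
  · exact ⟨q₀, hq₀, by rw [h]; exact hfan₀⟩
  exfalso
  obtain ⟨a₁, ha₁, ha₁S⟩ : ∃ a₁ ∈ Ico a s₀', ∀ s ∈ Ico a₁ s₀', s ∉ S := by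
    have hcl : (S \ {s₀'})ᶜ ∈ 𝓝 s₀' :=
      (hS.subset sdiff_subset).isClosed.isOpen_compl.mem_nhds (by simp)
    obtain ⟨ε, hε, hball⟩ := Metric.mem_nhds_iff.1 hcl
    refine ⟨max a (s₀' - ε / 2), ⟨le_max_left _ _, max_lt has (by linarith)⟩, fun s hs hsS => ?_⟩
    have h1 := (le_max_right _ _).trans hs.1
    refine hball (?_ : s ∈ _) ⟨hsS, hs.2.ne⟩
    rw [Metric.mem_ball, Real.dist_eq, abs_lt]
    constructor <;> linarith [hs.2]
  have ha₁0 : 0 < a₁ := ha.1.trans_le ha₁.1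
  -- at time `a₁` the fan stays above by a definite amount
  obtain ⟨Δ, hΔ, hΔle⟩ : ∃ Δ > 0, ∀ q ∈ I, U (x₀, t₀) + Δ ≤ fan f U x₀ t₀ q a₁ := by
    have hc : ContinuousOn (fun q => fan f U x₀ t₀ q a₁) I :=
      hfc.comp (f := fun q : ℝ => (q, a₁)) (by fun_prop) fun q hq =>
        ⟨mem_univ _, ha₁0, by simp only; linarith [ha₁.2, hs₀.2, ht₀.2]⟩
    obtain ⟨qm, hqm, hmin⟩ := isCompact_Icc.exists_isMinOn hIne hc
    refine ⟨fan f U x₀ t₀ qm a₁ - U (x₀, t₀), ?_, fun q hq => by linarith [isMinOn_iff.1 hmin q hq]⟩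
    by_contra! h
    have := hleast ⟨(qm, a₁), ⟨⟨hqm, ha₁.1, by simp only; linarith [ha₁.2, hs₀.2]⟩, by
      rw [mem_preimage, mem_Iic]; simp only; linarith⟩, rfl⟩
    simp only at this
    linarith [ha₁.2]
  -- below the level `U (x₀, t₀) + κ` the time `a₁` is not reached, and the edge lemmas apply
  set κ := min Δ (min κ₁ κ₂) with hκ
  have hκ0 : 0 < κ := by positivity
  obtain ⟨b, hb, hbfan⟩ : ∃ b ∈ Ioo a₁ s₀', fan f U x₀ t₀ q₀ b < U (x₀, t₀) + κ / 2 := by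
    have hc : ContinuousAt (fun s => fan f U x₀ t₀ q₀ s) s₀' := by
      have : ContinuousAt (fun p : ℝ × ℝ => fan f U x₀ t₀ p.1 p.2) (q₀, s₀') :=
        hfc.continuousAt ((isOpen_univ.prod isOpen_Ioo).mem_nhds
          (hsub (show (q₀, s₀') ∈ _ from ⟨hq₀, hs₀⟩)))
      exact this.comp (f := fun s : ℝ => (q₀, s)) (by fun_prop)
    have h1 : ∀ᶠ s in 𝓝[<] s₀', fan f U x₀ t₀ q₀ s < U (x₀, t₀) + κ / 2 := by
      refine nhdsWithin_le_nhds (hc.eventually (gt_mem_nhds ?_))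
      have : fan f U x₀ t₀ q₀ s₀' ≤ U (x₀, t₀) := hfan₀
      linarith
    exact ((eventually_mem_set.2 (Ioo_mem_nhdsLT ha₁.2)).and h1).exists
  have ht₀0 := ht₀.1
  set ε := κ / (4 * t₀) with hε
  have hε0 : 0 < ε := by positivity
  have hεt : ε * t₀ = κ / 4 := by rw [hε]; field_simp
  -- minimise the fan with a small penalty on time
  have hcpt' : IsCompact (I ×ˢ Icc a₁ b) := isCompact_Icc.prod isCompact_Icc
  have hsub' : I ×ˢ Icc a₁ b ⊆ I ×ˢ Icc a t₀ :=
    prod_mono le_rfl (Icc_subset_Icc ha₁.1 (hb.2.le.trans hs₀.2))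
  obtain ⟨⟨q, s⟩, ⟨hqI, hs⟩, hmin⟩ := hcpt'.exists_isMinOn
    (f := fun p : ℝ × ℝ => fan f U x₀ t₀ p.1 p.2 + ε * p.2)
    (hIne.prod ⟨b, hb.1.le, le_rfl⟩)
    ((hfc.mono (hsub'.trans hsub)).add (by fun_prop))
  rw [isMinOn_iff] at hmin
  simp only at hqI hs hmin
  have hsT : s ∈ Ioo 0 T := (hsub (hsub' (show (q, s) ∈ _ from ⟨hqI, hs⟩))).2
  have hst₀ : s < t₀ := by linarith [hs.2, hb.2, hs₀.2]
  have hval : fan f U x₀ t₀ q s < U (x₀, t₀) + κ := by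
    have h1 := hmin (q₀, b) ⟨hq₀, hb.1.le, le_rfl⟩
    simp only at h1
    have h2 : ε * (b - s) ≤ ε * t₀ := by
      gcongr; linarith [hb.2, hs₀.2, hsT.1]
    linarith
  have has₁ : a₁ < s := by
    refine lt_of_le_of_ne hs.1 fun h => ?_
    have := hΔle q hqI
    rw [h] at this
    linarith [min_le_left Δ (min κ₁ κ₂)]
  have hminq : ∀ q' ∈ I, fan f U x₀ t₀ q s ≤ fan f U x₀ t₀ q' s := fun q' hq' => by
    have := hmin (q', s) ⟨hq', hs⟩
    simp only at this
    linarith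
  have hpE : (x₀ - deriv f q * (t₀ - s), s) ∉ E :=
    hSE q hqI s ⟨ha₁.1.trans hs.1, hst₀.le⟩ (ha₁S s ⟨hs.1, hs.2.trans_lt hb.2⟩)
  obtain ⟨l, r, hrl, hdr, hdl, hae⟩ := exists_oneSided_states hst hU hf.continuous hv hsT
    (hreg _ ⟨⟨mem_univ _, hsT⟩, hpE⟩)
  have hcr : deriv f q ≤ deriv f r := by
    rcases (hmono hqI.1).eq_or_lt with h | h
    · rw [← h]
      refine hedge₁ s ⟨hsT.1, hst₀⟩ r (by rw [h]; exact hdr) ?_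
      rw [fan_congr hf hmono h]
      linarith [min_le_right Δ (min κ₁ κ₂), min_le_left κ₁ κ₂]
    · exact deriv_flux_le_of_fan_le hf hf' hmono hst₀ hqI.1 h hdr fun q' hq' =>
        hminq q' ⟨hq'.1, hq'.2.trans hqI.2⟩
  have hcl : deriv f l ≤ deriv f q := by
    rcases (hmono hqI.2).eq_or_lt with h | h
    · rw [h]
      refine hedge₂ s ⟨hsT.1, hst₀⟩ l (by rw [← h]; exact hdl) ?_
      rw [← fan_congr hf hmono h]
      linarith [min_le_right Δ (min κ₁ κ₂), min_le_right κ₁ κ₂]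
    · exact le_deriv_flux_of_fan_le hf hf' hmono hst₀ hqI.2 h hdl fun q' hq' =>
        hminq q' ⟨hqI.1.trans hq'.1, hq'.2⟩
  have hrl' := hmono hrl
  have hdesc := hU.eventually_fan_le hf hmono hsT (hcl.antisymm (hcr.trans hrl'))
    ((hrl'.trans hcl).antisymm hcr) hae (half_pos hε0)
  obtain ⟨h, hh, hh0⟩ := (hdesc.and (Ioo_mem_nhdsGT (sub_pos.2 has₁))).exists
  have := hmin (q, s - h) ⟨hqI, by simp only; linarith [hh0.2], by
    simp only; linarith [hh0.1, hs.2]⟩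
  simp only at this
  nlinarith [mul_pos hε0 hh0.1]

/-- Comparison: along a calibrated line of `V` the potential `U` increases at most as fast as `V`,
and near `t = 0` they differ by `k + O(t)`. Only `v` has to be stable here. -/
theorem IsPotential.le_sub_const (hf : Differentiable ℝ f) (hf' : Continuous (deriv f))
    (hmono : Monotone (deriv f)) (hv : IsGeneralizedSolution f T g v)
    (hvs : IsPiecewiseSmooth T v) (hst : IsStable T v) (hV : IsPotential f T v V)
    (hU : IsPotential f T u U) {k : ℝ}
    (hk : ∀ R : ℝ, ∃ C : ℝ, ∀ t ∈ Ioo 0 (T / 2), ∀ x, |x| < R →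
      |V (x, t) - U (x, t) - k| ≤ C * t) {x₀ t₀ : ℝ} (ht₀ : t₀ ∈ Ioo 0 T) :
    U (x₀, t₀) ≤ V (x₀, t₀) - k := by
  obtain ⟨q₁, q₂, hq⟩ := exists_fan_le hf hf' hmono hv hvs hst hV (x₀ := x₀) ht₀
  obtain ⟨B, hB⟩ := (isCompact_Icc (a := q₁) (b := q₂)).exists_bound_of_continuousOn
    hf'.continuousOn
  obtain ⟨C, hC⟩ := hk (|x₀| + |B| * t₀ + 1)
  have hev : ∀ᶠ a : ℝ in 𝓝[>] 0, U (x₀, t₀) ≤ V (x₀, t₀) - k + C * a := by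
    have hT : 0 < T := ht₀.1.trans ht₀.2
    filter_upwards [Ioo_mem_nhdsGT ht₀.1, Ioo_mem_nhdsGT (half_pos hT)] with a ha ha'
    obtain ⟨q, hqI, hfan⟩ := hq a ⟨ha.1, ha.2.le⟩
    have h1 := hU.fan_le_fan hf hmono (x₀ := x₀) (t₀ := t₀) (q := q) ha.1 ha.2.le ht₀.2
    rw [fan_self] at h1
    have hfoot : |x₀ - deriv f q * (t₀ - a)| < |x₀| + |B| * t₀ + 1 := by
      have e1 := abs_sub x₀ (deriv f q * (t₀ - a))
      have e2 : |deriv f q * (t₀ - a)| ≤ |B| * t₀ := by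
        rw [abs_mul]
        have := (hB q hqI).trans (le_abs_self B)
        rw [Real.norm_eq_abs] at this
        gcongr
        rw [abs_of_pos (by linarith [ha.2])]
        linarith [ha.1]
      linarith
    have h2 := (abs_le.1 (hC a ha' _ hfoot)).1
    rw [fan] at h1 hfan
    linarith
  have hlim : Tendsto (fun a : ℝ => V (x₀, t₀) - k + C * a) (𝓝[>] 0) (𝓝 (V (x₀, t₀) - k)) := by
    have hc : Continuous fun a : ℝ => V (x₀, t₀) - k + C * a := by fun_prop
    have := (hc.tendsto 0).mono_left (nhdsWithin_le_nhds (s := Ioi 0))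
    simpa using this
  exact ge_of_tendsto hlim hev

/-- Stable piecewise smooth solutions with the same initial value agree almost everywhere. -/
theorem ae_eq_of_stable (hT : 0 < T) (hf : Differentiable ℝ f) (hf' : Continuous (deriv f))
    (hmono : Monotone (deriv f)) (hv : IsGeneralizedSolution f T g v)
    (hvs : IsPiecewiseSmooth T v) (hvst : IsStable T v) (hu : IsGeneralizedSolution f T g u)
    (hus : IsPiecewiseSmooth T u) (hust : IsStable T u) :
    Function.uncurry v =ᵐ[volume.restrict (strip T)] Function.uncurry u := by
  obtain ⟨V, hV⟩ := exists_potential hT hf.continuous hv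
  obtain ⟨U, hU⟩ := exists_potential hT hf.continuous hu
  obtain ⟨k, hk⟩ := exists_const_potential_sub_tendsto hT hf.continuous hv hvs hV hu hus hU
  have hk' : ∀ R : ℝ, ∃ C : ℝ, ∀ t ∈ Ioo 0 (T / 2), ∀ x, |x| < R →
      |U (x, t) - V (x, t) - -k| ≤ C * t := by
    intro R
    obtain ⟨C, hC⟩ := hk R
    refine ⟨C, fun t ht x hx => ?_⟩
    rw [← abs_neg]
    convert hC t ht x hx using 2
    ring
  have heq : ∀ t ∈ Ioo 0 T, ∀ x, V (x, t) = U (x, t) + k := fun t ht x => by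
    have h1 := hV.le_sub_const hf hf' hmono hv hvs hvst hU hk (x₀ := x) ht
    have h2 := hU.le_sub_const hf hf' hmono hu hus hust hV hk' (x₀ := x) ht
    linarith
  filter_upwards [hvs.ae_continuousAt, hus.ae_continuousAt,
    ae_restrict_mem (measurableSet_strip T)] with ⟨x, t⟩ hvc huc hmem
  have h1 := hV.hasDerivAt hmem.2 hvc
  have h2 := (hU.hasDerivAt hmem.2 huc).add_const k
  have : (fun y => V (y, t)) = fun y => U (y, t) + k := funext fun y => heq t hmem.2 y
  rw [this] at h1
  exact h1.unique h2

end Potential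

section Front

variable {f : ℝ → ℝ} {T : ℝ} {u₀₀ e₀ : ℝ → ℝ} {x₀ : ℝ} {u₀ e : ℝ → ℝ → ℝ} {φ : ℝ → ℝ}

/-! ### The strength of the shock -/

lemma closedStrip_mem_nhds {p : ℝ × ℝ} (hp : p ∈ strip T) :
    (univ ×ˢ Icc 0 T : Set (ℝ × ℝ)) ∈ 𝓝 p :=
  mem_of_superset ((isOpen_strip T).mem_nhds hp) (prod_mono le_rfl Ioo_subset_Icc_self)

lemma lawOp_eq {w : ℝ → ℝ → ℝ} (hf : Differentiable ℝ f) {x t : ℝ}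
    (hw : DifferentiableAt ℝ (Function.uncurry w) (x, t)) :
    lawOp f w x t = fderiv ℝ (Function.uncurry w) (x, t) (0, 1)
      + deriv f (w x t) * fderiv ℝ (Function.uncurry w) (x, t) (1, 0) := by
  have h1 : HasDerivAt (fun s => w x s) (fderiv ℝ (Function.uncurry w) (x, t) (0, 1)) t :=
    hw.hasFDerivAt.comp_hasDerivAt t ((hasDerivAt_const t x).prodMk (hasDerivAt_id t))
  have h2 : HasDerivAt (fun y => w y t) (fderiv ℝ (Function.uncurry w) (x, t) (1, 0)) x :=
    HasFDerivAt.comp_hasDerivAt x (f := fun y : ℝ => (y, t)) hw.hasFDerivAt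
      ((hasDerivAt_id x).prodMk (hasDerivAt_const x t))
  have h3 := ((hf (w x t)).hasDerivAt.comp x h2).deriv
  rw [lawOp, h1.deriv]
  congr 1

namespace SolvesShockSystem

lemma contDiffAt_right (h : SolvesShockSystem f T u₀₀ e₀ x₀ u₀ e φ) {p : ℝ × ℝ} (hp : p ∈ strip T) :
    ContDiffAt ℝ ∞ (Function.uncurry u₀) p :=
  h.smooth_u₀.contDiffAt (closedStrip_mem_nhds hp)

lemma smooth_left (h : SolvesShockSystem f T u₀₀ e₀ x₀ u₀ e φ) :
    ContDiffOn ℝ ∞ (Function.uncurry fun x t => u₀ x t + e x t) (univ ×ˢ Icc 0 T) :=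
  h.smooth_u₀.add h.smooth_e

lemma contDiffAt_left (h : SolvesShockSystem f T u₀₀ e₀ x₀ u₀ e φ) {p : ℝ × ℝ} (hp : p ∈ strip T) :
    ContDiffAt ℝ ∞ (Function.uncurry fun x t => u₀ x t + e x t) p :=
  h.smooth_left.contDiffAt (closedStrip_mem_nhds hp)

lemma contDiffAt_front (h : SolvesShockSystem f T u₀₀ e₀ x₀ u₀ e φ) {t : ℝ}
    (ht : t ∈ Ioo 0 T) : ContDiffAt ℝ ∞ φ t :=
  h.smooth_φ.contDiffAt (Icc_mem_nhds ht.1 ht.2)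

end SolvesShockSystem

/-- The differential expression `w_t + f'(w) w_x`, written with the Fréchet derivative so that it is
visibly continuous for smooth `w`. -/
noncomputable def residual (f : ℝ → ℝ) (w : ℝ × ℝ → ℝ) (p : ℝ × ℝ) : ℝ :=
  fderiv ℝ w p (0, 1) + deriv f (w p) * fderiv ℝ w p (1, 0)

lemma continuousAt_fderiv_apply {w : ℝ × ℝ → ℝ} {p : ℝ × ℝ} (hw : ContDiffAt ℝ ∞ w p)
    (d : ℝ × ℝ) : ContinuousAt (fun p => fderiv ℝ w p d) p :=
  ((hw.fderiv_right (m := 0) (by simp)).continuousAt).clm_apply continuousAt_const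

lemma continuousAt_residual (hf' : Continuous (deriv f)) {w : ℝ × ℝ → ℝ} {p : ℝ × ℝ}
    (hw : ContDiffAt ℝ ∞ w p) : ContinuousAt (residual f w) p :=
  (continuousAt_fderiv_apply hw _).add
    ((hf'.continuousAt.comp hw.continuousAt).mul (continuousAt_fderiv_apply hw _))

lemma hasDerivAt_along {w : ℝ × ℝ → ℝ} {t c : ℝ} (hw : DifferentiableAt ℝ w (φ t, t))
    (hφ : HasDerivAt φ c t) :
    HasDerivAt (fun s => w (φ s, s)) (fderiv ℝ w (φ t, t) (0, 1) + c * fderiv ℝ w (φ t, t) (1, 0))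
      t := by
  have := HasFDerivAt.comp_hasDerivAt t (f := fun s : ℝ => (φ s, s)) hw.hasFDerivAt
    (hφ.prodMk (hasDerivAt_id t))
  rw [show ((c, 1) : ℝ × ℝ) = (0, 1) + c • (1, 0) by ext <;> simp, map_add, map_smul,
    smul_eq_mul] at this
  exact this

namespace SolvesShockSystem

lemma residual_right (h : SolvesShockSystem f T u₀₀ e₀ x₀ u₀ e φ) (hf : Differentiable ℝ f)
    {p : ℝ × ℝ} (hp : p ∈ strip T) (hpφ : φ p.2 < p.1) :
    residual f (Function.uncurry u₀) p = 0 := by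
  rw [← h.right_eq p.2 hp.2 p.1 hpφ, lawOp_eq hf
    ((h.contDiffAt_right hp).differentiableAt (by simp))]
  rfl

lemma residual_left (h : SolvesShockSystem f T u₀₀ e₀ x₀ u₀ e φ) (hf : Differentiable ℝ f)
    {p : ℝ × ℝ} (hp : p ∈ strip T) (hpφ : p.1 < φ p.2) :
    residual f (Function.uncurry fun x t => u₀ x t + e x t) p = 0 := by
  rw [← h.left_eq p.2 hp.2 p.1 hpφ, lawOp_eq hf
    ((h.contDiffAt_left hp).differentiableAt (by simp))]
  rfl

lemma residual_right_front (h : SolvesShockSystem f T u₀₀ e₀ x₀ u₀ e φ) (hf : Differentiable ℝ f)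
    (hf' : Continuous (deriv f)) {t : ℝ} (ht : t ∈ Ioo 0 T) :
    residual f (Function.uncurry u₀) (φ t, t) = 0 := by
  have hc := continuousAt_residual hf' (h.contDiffAt_right (p := (φ t, t)) ⟨mem_univ _, ht⟩)
  have h1 : Tendsto (fun y => residual f (Function.uncurry u₀) (y, t)) (𝓝[>] φ t)
      (𝓝 (residual f (Function.uncurry u₀) (φ t, t))) :=
    (hc.comp (f := fun y : ℝ => (y, t)) (by fun_prop)).mono_left nhdsWithin_le_nhds
  refine tendsto_nhds_unique h1 (tendsto_const_nhds.congr' ?_)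
  filter_upwards [self_mem_nhdsWithin] with y hy
  exact (h.residual_right hf (p := (y, t)) ⟨mem_univ _, ht⟩ hy).symm

lemma residual_left_front (h : SolvesShockSystem f T u₀₀ e₀ x₀ u₀ e φ) (hf : Differentiable ℝ f)
    (hf' : Continuous (deriv f)) {t : ℝ} (ht : t ∈ Ioo 0 T) :
    residual f (Function.uncurry fun x t => u₀ x t + e x t) (φ t, t) = 0 := by
  have hc := continuousAt_residual hf' (h.contDiffAt_left (p := (φ t, t)) ⟨mem_univ _, ht⟩)
  have h1 : Tendsto (fun y => residual f (Function.uncurry fun x t => u₀ x t + e x t) (y, t))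
      (𝓝[<] φ t) (𝓝 (residual f (Function.uncurry fun x t => u₀ x t + e x t) (φ t, t))) :=
    (hc.comp (f := fun y : ℝ => (y, t)) (by fun_prop)).mono_left nhdsWithin_le_nhds
  refine tendsto_nhds_unique h1 (tendsto_const_nhds.congr' ?_)
  filter_upwards [self_mem_nhdsWithin] with y hy
  exact (h.residual_left hf (p := (y, t)) ⟨mem_univ _, ht⟩ hy).symm

lemma continuousOn_front_comp (h : SolvesShockSystem f T u₀₀ e₀ x₀ u₀ e φ) {E : Type*}
    [TopologicalSpace E] {w : ℝ × ℝ → E} (hw : ContinuousOn w (univ ×ˢ Icc 0 T)) :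
    ContinuousOn (fun t => w (φ t, t)) (Icc 0 T) :=
  hw.comp (h.smooth_φ.continuousOn.prodMk continuousOn_id) fun _ ht => ⟨mem_univ _, ht⟩

/-- The bound is uniform up to `t = 0` and `t = T`, where it comes from the one-sided derivatives
within the closed strip. -/
lemma exists_front_slope_bound (h : SolvesShockSystem f T u₀₀ e₀ x₀ u₀ e φ) (hT : 0 < T)
    {w : ℝ × ℝ → ℝ} (hw : ContDiffOn ℝ ∞ w (univ ×ˢ Icc 0 T)) :
    ∃ D, 0 ≤ D ∧ ∀ t ∈ Ioo 0 T, |fderiv ℝ w (φ t, t) (1, 0)| ≤ D := by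
  have hu : UniqueDiffOn ℝ (univ ×ˢ Icc 0 T : Set (ℝ × ℝ)) :=
    uniqueDiffOn_univ.prod (uniqueDiffOn_Icc hT)
  have hc := h.continuousOn_front_comp
    ((hw.continuousOn_fderivWithin hu (by simp)).clm_apply
      (continuousOn_const (c := ((1 : ℝ), (0 : ℝ)))))
  obtain ⟨D, hD⟩ := isCompact_Icc.exists_bound_of_continuousOn hc
  refine ⟨max D 0, le_max_right _ _, fun t ht => ?_⟩
  have := hD t (Ioo_subset_Icc_self ht)
  rw [fderivWithin_of_mem_nhds (closedStrip_mem_nhds ⟨mem_univ _, ht⟩)] at this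
  exact this.trans (le_max_left _ _)

/-- The values of `u₀` and `e` at `(x₀, 0)` are determined by the initial conditions, which are
imposed only off `x₀`, through continuity. -/
lemma init_front_pos (h : SolvesShockSystem f T u₀₀ e₀ x₀ u₀ e φ) (hT : 0 < T)
    (hu₀₀ : Continuous u₀₀) (he₀ : Continuous e₀) (he₀_pos : ∀ x, 0 < e₀ x) : 0 < e (φ 0) 0 := by
  have hc : ∀ {w : ℝ → ℝ → ℝ}, ContDiffOn ℝ ∞ (Function.uncurry w) (univ ×ˢ Icc 0 T) →
      Continuous fun x => w x 0 := fun hw =>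
    continuousOn_univ.1 (hw.continuousOn.comp (f := fun x : ℝ => (x, (0 : ℝ)))
      (by fun_prop) fun x _ => ⟨mem_univ _, le_rfl, hT.le⟩)
  have h1 : u₀ x₀ 0 = u₀₀ x₀ := by
    have l1 := ((hc h.smooth_u₀).tendsto x₀).mono_left (nhdsWithin_le_nhds (s := Ioi x₀))
    have l2 := (hu₀₀.tendsto x₀).mono_left (nhdsWithin_le_nhds (s := Ioi x₀))
    refine tendsto_nhds_unique l1 (l2.congr' ?_)
    filter_upwards [self_mem_nhdsWithin] with x hx
    exact (h.init_right x hx).symm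
  have h2 : u₀ x₀ 0 + e x₀ 0 = u₀₀ x₀ + e₀ x₀ := by
    have l1 := ((hc h.smooth_left).tendsto x₀).mono_left (nhdsWithin_le_nhds (s := Iio x₀))
    have l2 := ((hu₀₀.add he₀).tendsto x₀).mono_left (nhdsWithin_le_nhds (s := Iio x₀))
    refine tendsto_nhds_unique l1 (l2.congr' ?_)
    filter_upwards [self_mem_nhdsWithin] with x hx
    exact (h.init_left x hx).symm
  rw [h.init_φ]
  linarith [he₀_pos x₀]

/-- The strength of the shock stays positive. As long as it is positive, the speed of the front lies
between the characteristic speeds on its two sides, and the derivative of the strength along the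
front is at least `-C` times the strength, with `C` uniform on `(0, T)`; so the strength multiplied
by `exp (C t)` cannot decrease. -/
lemma front_pos (h : SolvesShockSystem f T u₀₀ e₀ x₀ u₀ e φ) (hf : ContDiff ℝ ∞ f)
    (hmono : Monotone (deriv f)) (hu₀₀ : Continuous u₀₀) (he₀ : Continuous e₀)
    (he₀_pos : ∀ x, 0 < e₀ x) {t : ℝ} (ht : t ∈ Ioo 0 T) : 0 < e (φ t) t := by
  have hT : 0 < T := ht.1.trans ht.2
  have hfd : Differentiable ℝ f := hf.differentiable (by simp)
  have hf1 : ContDiff ℝ ∞ (deriv f) := hf.iterate_deriv 1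
  have hf2 : Continuous (deriv (deriv f)) := hf1.continuous_deriv (by simp)
  set A := Function.uncurry u₀ with hA
  set B := Function.uncurry (fun x t => u₀ x t + e x t) with hB
  have hAc := h.continuousOn_front_comp h.smooth_u₀.continuousOn
  have hBc := h.continuousOn_front_comp h.smooth_left.continuousOn
  have hEc := h.continuousOn_front_comp h.smooth_e.continuousOn
  obtain ⟨m₁, hm₁⟩ := isCompact_Icc.exists_bound_of_continuousOn hAc
  obtain ⟨m₂, hm₂⟩ := isCompact_Icc.exists_bound_of_continuousOn hBc
  set m := max m₁ m₂
  obtain ⟨L, hL⟩ := (isCompact_Icc (a := -m) (b := m)).exists_bound_of_continuousOn hf2.continuousOn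
  obtain ⟨D₁, hD₁0, hD₁⟩ := h.exists_front_slope_bound hT h.smooth_u₀
  obtain ⟨D₂, hD₂0, hD₂⟩ := h.exists_front_slope_bound hT h.smooth_left
  by_contra! hneg
  -- the first time at which the strength is not positive
  have hcpt : IsCompact (Icc 0 t ∩ (fun t => e (φ t) t) ⁻¹' Iic 0) :=
    isCompact_Icc.of_isClosed_subset ((hEc.mono (Icc_subset_Icc le_rfl ht.2.le)
      ).preimage_isClosed_of_isClosed isClosed_Icc isClosed_Iic) inter_subset_left
  obtain ⟨s, ⟨hs, hes⟩, hleast⟩ := hcpt.exists_isLeast ⟨t, ⟨ht.1.le, le_rfl⟩, hneg⟩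
  have he0 := h.init_front_pos hT hu₀₀ he₀ he₀_pos
  have hes' : e (φ s) s ≤ 0 := hes
  have hs0 : 0 < s := hs.1.lt_of_ne fun h0 => by rw [← h0] at hes'; linarith
  have hpos : ∀ r ∈ Ico 0 s, 0 < e (φ r) r := by
    intro r hr
    by_contra! hr'
    exact absurd (hleast ⟨⟨hr.1, hr.2.le.trans hs.2⟩, hr'⟩) (not_le.2 hr.2)
  set C := L * (D₁ + D₂)
  have hsT : s < T := hs.2.trans_lt ht.2
  have hder : ∀ r ∈ Ioo 0 s, ∃ E', HasDerivAt (fun t => e (φ t) t) E' r ∧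
      0 ≤ E' + C * e (φ r) r := by
    intro r hr
    have hrT : r ∈ Ioo 0 T := ⟨hr.1, hr.2.trans hsT⟩
    have hrs : (φ r, r) ∈ strip T := ⟨mem_univ _, hrT⟩
    have hφ : HasDerivAt φ (deriv φ r) r :=
      ((h.contDiffAt_front hrT).differentiableAt (by simp)).hasDerivAt
    have d1 := hasDerivAt_along ((h.contDiffAt_right hrs).differentiableAt (by simp)) hφ
    have d2 := hasDerivAt_along ((h.contDiffAt_left hrs).differentiableAt (by simp)) hφ
    have r1 := h.residual_right_front hfd hf1.continuous hrT
    have r2 := h.residual_left_front hfd hf1.continuous hrT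
    have hEpos := hpos r ⟨hr.1.le, hr.2⟩
    have hfront := h.front_eq r hrT
    rw [eq_div_iff hEpos.ne'] at hfront
    have hd := d2.sub d1
    refine ⟨_, hd.congr_of_eventuallyEq (Eventually.of_forall fun y => ?_), ?_⟩
    · simp [Function.uncurry]
    · rw [residual] at r1 r2
      rw [← hA] at r1 ⊢
      rw [← hB] at r2 ⊢
      have hAr : A (φ r, r) = u₀ (φ r) r := rfl
      have hBr : B (φ r, r) = u₀ (φ r) r + e (φ r) r := rfl
      rw [hAr] at r1
      rw [hBr] at r2
      have b1 := abs_le.1 (hD₁ r hrT)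
      have b2 := abs_le.1 (hD₂ r hrT)
      rw [← hA] at b1
      rw [← hB] at b2
      set a := u₀ (φ r) r
      set ε := e (φ r) r
      set α := fderiv ℝ A (φ r, r) (1, 0)
      set β := fderiv ℝ B (φ r, r) (1, 0)
      -- the speed of the front lies between the characteristic speeds
      have t1 := tangent_le hfd hmono a (a + ε)
      have t2 := tangent_le hfd hmono (a + ε) a
      have s1 : deriv f a ≤ deriv φ r := by
        by_contra! hc
        nlinarith [mul_lt_mul_of_pos_right hc hEpos]
      have s2 : deriv φ r ≤ deriv f (a + ε) := by
        by_contra! hc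
        nlinarith [mul_lt_mul_of_pos_right hc hEpos]
      have hlip : deriv f (a + ε) - deriv f a ≤ L * ε := by
        have ma : a ∈ Icc (-m) m := abs_le.1 ((hm₁ r (Ioo_subset_Icc_self hrT)).trans
          (le_max_left _ _))
        have mb : a + ε ∈ Icc (-m) m := abs_le.1 ((hm₂ r (Ioo_subset_Icc_self hrT)).trans
          (le_max_right _ _))
        have := (convex_Icc (-m) m).norm_image_sub_le_of_norm_deriv_le
          (fun x _ => (hf1.differentiable (by simp)) x) hL ma mb
        rw [add_sub_cancel_left, Real.norm_eq_abs, Real.norm_eq_abs, abs_of_pos hEpos] at this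
        exact (le_abs_self _).trans this
      have k1 : (deriv f (a + ε) - deriv φ r) * β ≤ (deriv f (a + ε) - deriv f a) * D₂ := by
        calc _ ≤ (deriv f (a + ε) - deriv φ r) * D₂ := by
              apply mul_le_mul_of_nonneg_left b2.2; linarith
          _ ≤ _ := by apply mul_le_mul_of_nonneg_right _ hD₂0; linarith
      have k2 : (deriv φ r - deriv f a) * α ≤ (deriv f (a + ε) - deriv f a) * D₁ := by
        calc _ ≤ (deriv φ r - deriv f a) * D₁ := by
              apply mul_le_mul_of_nonneg_left b1.2; linarith
          _ ≤ _ := by apply mul_le_mul_of_nonneg_right _ hD₁0; linarith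
      have k3 : (deriv f (a + ε) - deriv f a) * (D₁ + D₂) ≤ L * ε * (D₁ + D₂) :=
        mul_le_mul_of_nonneg_right hlip (by linarith)
      have k4 : C * ε = L * ε * (D₁ + D₂) := by simp only [C]; ring
      rw [k4]
      nlinarith
  have hmonoE : MonotoneOn (fun t => e (φ t) t * Real.exp (C * t)) (Icc 0 s) := by
    have hexp : ∀ r, HasDerivAt (fun t => Real.exp (C * t)) (Real.exp (C * r) * C) r := fun r => by
      simpa using ((hasDerivAt_id r).const_mul C).exp
    refine monotoneOn_of_deriv_nonneg (convex_Icc 0 s)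
      ((hEc.mono (Icc_subset_Icc le_rfl hsT.le)).mul (by fun_prop)) (fun r hr => ?_) fun r hr => ?_
    · rw [interior_Icc] at hr
      obtain ⟨E', hE', -⟩ := hder r hr
      exact (hE'.mul (hexp r)).differentiableAt.differentiableWithinAt
    · rw [interior_Icc] at hr
      obtain ⟨E', hE', hle⟩ := hder r hr
      have hd : HasDerivAt (fun t => e (φ t) t * Real.exp (C * t))
          (E' * Real.exp (C * r) + e (φ r) r * (Real.exp (C * r) * C)) r := hE'.mul (hexp r)
      rw [hd.deriv]
      have := mul_nonneg hle (Real.exp_pos (C * r)).le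
      linarith
  have := hmonoE ⟨le_rfl, hs0.le⟩ ⟨hs0.le, le_rfl⟩ hs0.le
  simp only [mul_zero, Real.exp_zero, mul_one] at this
  have := mul_nonpos_of_nonpos_of_nonneg hes' (Real.exp_pos (C * s)).le
  linarith

end SolvesShockSystem

/-! ### Regularity, stability and initial value of the shock wave -/

lemma shock_of_lt {x t : ℝ} (hx : x < φ t) : shock u₀ e φ x t = u₀ x t + e x t := by
  rw [shock, heaviside, if_pos (by linarith), mul_one]

lemma shock_of_le {x t : ℝ} (hx : φ t ≤ x) : shock u₀ e φ x t = u₀ x t := by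
  rw [shock, heaviside, if_neg (by linarith), mul_zero, add_zero]

lemma abs_heaviside_le (ξ : ℝ) : |heaviside ξ| ≤ 1 := by
  rw [heaviside]; split_ifs <;> simp

lemma measurable_heaviside : Measurable heaviside :=
  Measurable.ite measurableSet_Ioi measurable_const measurable_const

lemma abs_shock_le (x t : ℝ) : |shock u₀ e φ x t| ≤ |u₀ x t| + |e x t| := by
  rw [shock]
  refine (abs_add_le _ _).trans ?_
  rw [abs_mul]
  have := mul_le_mul_of_nonneg_left (abs_heaviside_le (-x + φ t)) (abs_nonneg (e x t))
  linarith

namespace SolvesShockSystem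

lemma eventually_lt_front (h : SolvesShockSystem f T u₀₀ e₀ x₀ u₀ e φ) {p : ℝ × ℝ}
    (hp : p ∈ strip T) (hpφ : p.1 < φ p.2) : ∀ᶠ q in 𝓝 p, q.1 < φ q.2 :=
  continuous_fst.continuousAt.eventually_lt
    (ContinuousAt.comp (f := Prod.snd) (h.contDiffAt_front hp.2).continuousAt
      continuous_snd.continuousAt) hpφ

lemma eventually_front_lt (h : SolvesShockSystem f T u₀₀ e₀ x₀ u₀ e φ) {p : ℝ × ℝ}
    (hp : p ∈ strip T) (hpφ : φ p.2 < p.1) : ∀ᶠ q in 𝓝 p, φ q.2 < q.1 :=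
  (ContinuousAt.comp (f := Prod.snd) (h.contDiffAt_front hp.2).continuousAt
      continuous_snd.continuousAt).eventually_lt continuous_fst.continuousAt hpφ

lemma contDiffAt_shock (h : SolvesShockSystem f T u₀₀ e₀ x₀ u₀ e φ) {p : ℝ × ℝ}
    (hp : p ∈ strip T) (hpφ : p.1 ≠ φ p.2) :
    ContDiffAt ℝ 1 (Function.uncurry (shock u₀ e φ)) p := by
  rcases lt_or_gt_of_ne hpφ with hlt | hgt
  · refine ((h.contDiffAt_left hp).of_le (by simp)).congr_of_eventuallyEq ?_
    filter_upwards [h.eventually_lt_front hp hlt] with q hq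
    exact shock_of_lt hq
  · refine ((h.contDiffAt_right hp).of_le (by simp)).congr_of_eventuallyEq ?_
    filter_upwards [h.eventually_front_lt hp hgt] with q hq
    exact shock_of_le hq.le

lemma isPiecewiseSmooth (h : SolvesShockSystem f T u₀₀ e₀ x₀ u₀ e φ) :
    IsPiecewiseSmooth T (shock u₀ e φ) := by
  refine ⟨∅, by simp, fun p hp => ?_⟩
  have hp := hp.1
  by_cases hpφ : p.1 = φ p.2
  · refine Or.inr ⟨φ, (h.contDiffAt_front hp.2).of_le (by simp), hpφ.symm, ?_, ?_, ?_⟩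
    · filter_upwards [(isOpen_strip T).mem_nhds hp] with q hq hne
      exact h.contDiffAt_shock hq hne
    · refine ⟨_, ((h.contDiffAt_left hp).continuousAt.tendsto.mono_left
        nhdsWithin_le_nhds).congr' ?_⟩
      filter_upwards [self_mem_nhdsWithin] with q hq
      exact (shock_of_lt hq).symm
    · refine ⟨_, ((h.contDiffAt_right hp).continuousAt.tendsto.mono_left
        nhdsWithin_le_nhds).congr' ?_⟩
      filter_upwards [self_mem_nhdsWithin] with q hq
      exact (shock_of_le (le_of_lt hq)).symm
  · exact Or.inl (h.contDiffAt_shock hp hpφ)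

lemma isStable (h : SolvesShockSystem f T u₀₀ e₀ x₀ u₀ e φ)
    (hpos : ∀ t ∈ Ioo 0 T, 0 < e (φ t) t) : IsStable T (shock u₀ e φ) := by
  intro x t ht l r hl hr hlr
  have hp : (x, t) ∈ strip T := ⟨mem_univ _, ht⟩
  have hslice : ∀ {w : ℝ × ℝ → ℝ}, ContinuousAt w (x, t) →
      Tendsto (fun y => w (y, t)) (𝓝 x) (𝓝 (w (x, t))) := fun hw =>
    ContinuousAt.comp (f := fun y : ℝ => (y, t)) hw (by fun_prop)
  by_cases hx : x = φ t
  · have l1 := (hslice (h.contDiffAt_left hp).continuousAt).mono_left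
      (nhdsWithin_le_nhds (s := Iio x))
    have r1 := (hslice (h.contDiffAt_right hp).continuousAt).mono_left
      (nhdsWithin_le_nhds (s := Ioi x))
    have l2 : l = u₀ x t + e x t := tendsto_nhds_unique hl (l1.congr' (by
      filter_upwards [self_mem_nhdsWithin] with y hy
      exact (shock_of_lt (hx ▸ hy)).symm))
    have r2 : r = u₀ x t := tendsto_nhds_unique hr (r1.congr' (by
      filter_upwards [self_mem_nhdsWithin] with y hy
      exact (shock_of_le (le_of_lt (hx ▸ hy))).symm))
    have := hpos t ht
    rw [← hx] at this
    linarith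
  · have hc := hslice (h.contDiffAt_shock hp hx).continuousAt
    exact absurd ((tendsto_nhds_unique hl (hc.mono_left nhdsWithin_le_nhds)).trans
      (tendsto_nhds_unique hr (hc.mono_left nhdsWithin_le_nhds)).symm) hlr

lemma aestronglyMeasurable (h : SolvesShockSystem f T u₀₀ e₀ x₀ u₀ e φ) :
    AEStronglyMeasurable (Function.uncurry (shock u₀ e φ)) (volume.restrict (strip T)) := by
  have hsub : strip T ⊆ univ ×ˢ Icc 0 T := prod_mono le_rfl Ioo_subset_Icc_self
  have h1 : AEStronglyMeasurable (Function.uncurry u₀) (volume.restrict (strip T)) :=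
    (h.smooth_u₀.continuousOn.mono hsub).aestronglyMeasurable (measurableSet_strip T)
  have h2 : AEStronglyMeasurable (Function.uncurry e) (volume.restrict (strip T)) :=
    (h.smooth_e.continuousOn.mono hsub).aestronglyMeasurable (measurableSet_strip T)
  have h3 : ContinuousOn (fun p : ℝ × ℝ => -p.1 + φ p.2) (strip T) :=
    continuous_fst.neg.continuousOn.add
      ((h.smooth_φ.continuousOn.mono Ioo_subset_Icc_self).comp continuousOn_snd fun p hp => hp.2)
  have h4 := measurable_heaviside.comp_aemeasurable
    (h3.aemeasurable (μ := volume) (measurableSet_strip T))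
  exact h1.add (h2.mul h4.aestronglyMeasurable)

lemma locallyBounded (h : SolvesShockSystem f T u₀₀ e₀ x₀ u₀ e φ) {K : Set (ℝ × ℝ)}
    (hK : IsCompact K) (hKs : K ⊆ univ ×ˢ Icc 0 T) : ∃ M : ℝ, ∀ p ∈ K,
      |shock u₀ e φ p.1 p.2| ≤ M := by
  obtain ⟨M₁, h₁⟩ := hK.exists_bound_of_continuousOn (h.smooth_u₀.continuousOn.mono hKs)
  obtain ⟨M₂, h₂⟩ := hK.exists_bound_of_continuousOn (h.smooth_e.continuousOn.mono hKs)
  exact ⟨M₁ + M₂, fun p hp => (abs_shock_le _ _).trans (add_le_add (h₁ p hp) (h₂ p hp))⟩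

lemma initialValue (h : SolvesShockSystem f T u₀₀ e₀ x₀ u₀ e φ) (hT : 0 < T) {ψ : ℝ → ℝ}
    (hψ : Continuous ψ) (hψc : HasCompactSupport ψ) :
    Tendsto (fun t => ∫ x, shock u₀ e φ x t * ψ x) (𝓝[>] 0)
      (𝓝 (∫ x, initialStep u₀₀ e₀ x₀ x * ψ x)) := by
  obtain ⟨M, hM⟩ := h.locallyBounded (hψc.isCompact.prod (isCompact_Icc (a := 0) (b := T)))
    (prod_mono (subset_univ _) le_rfl)
  have hlim : ∀ {w : ℝ → ℝ → ℝ}, ContDiffOn ℝ ∞ (Function.uncurry w) (univ ×ˢ Icc 0 T) → ∀ x,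
      Tendsto (fun t => w x t) (𝓝[>] 0) (𝓝 (w x 0)) := by
    intro w hw x
    have hc := hw.continuousOn (x, 0) ⟨mem_univ _, le_rfl, hT.le⟩
    refine hc.tendsto.comp (f := fun t : ℝ => (x, t)) (tendsto_nhdsWithin_iff.2 ⟨?_, ?_⟩)
    · exact (Continuous.tendsto (by fun_prop) (0 : ℝ)).mono_left nhdsWithin_le_nhds
    · filter_upwards [Ioo_mem_nhdsGT hT] with t ht
      exact ⟨mem_univ _, ht.1.le, ht.2.le⟩
  have hφlim : Tendsto φ (𝓝[>] 0) (𝓝 x₀) := by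
    rw [← h.init_φ]
    refine (h.smooth_φ.continuousOn 0 ⟨le_rfl, hT.le⟩).tendsto.mono_left
      (nhdsWithin_le_of_mem ?_)
    filter_upwards [Ioo_mem_nhdsGT hT] with t ht
    exact ⟨ht.1.le, ht.2.le⟩
  refine tendsto_integral_filter_of_dominated_convergence (fun x => M * |ψ x|) ?_ ?_ ?_ ?_
  · filter_upwards [Ioo_mem_nhdsGT hT] with t ht
    have hc : ∀ {w : ℝ → ℝ → ℝ}, ContDiffOn ℝ ∞ (Function.uncurry w) (univ ×ˢ Icc 0 T) →
        Continuous fun x => w x t := fun hw =>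
      continuousOn_univ.1 (hw.continuousOn.comp (f := fun x : ℝ => (x, t))
        (by fun_prop) fun x _ => ⟨mem_univ _, ht.1.le, ht.2.le⟩)
    have hm : Measurable fun x : ℝ => heaviside (-x + φ t) :=
      measurable_heaviside.comp (by fun_prop)
    exact (((hc h.smooth_u₀).measurable.add ((hc h.smooth_e).measurable.mul hm)).mul
      hψ.measurable).aestronglyMeasurable
  · filter_upwards [Ioo_mem_nhdsGT hT] with t ht
    refine Eventually.of_forall fun x => ?_
    rw [Real.norm_eq_abs, abs_mul]
    by_cases hx : x ∈ tsupport ψ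
    · exact mul_le_mul_of_nonneg_right (hM (x, t) ⟨hx, ht.1.le, ht.2.le⟩) (abs_nonneg _)
    · simp [image_eq_zero_of_notMem_tsupport hx]
  · exact (hψ.abs.integrable_of_hasCompactSupport hψc.abs).const_mul M
  · filter_upwards [Measure.ae_ne volume x₀] with x hx
    refine Tendsto.mul_const _ ?_
    rcases lt_or_gt_of_ne hx with hlt | hgt
    · have hval : initialStep u₀₀ e₀ x₀ x = u₀ x 0 + e x 0 := by
        rw [initialStep, heaviside, if_pos (by linarith), mul_one, h.init_left x hlt]
      rw [hval]
      refine (hlim h.smooth_left x).congr' ?_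
      filter_upwards [hφlim.eventually (lt_mem_nhds hlt)] with t ht
      exact (shock_of_lt ht).symm
    · have hval : initialStep u₀₀ e₀ x₀ x = u₀ x 0 := by
        rw [initialStep, heaviside, if_neg (by linarith), mul_zero, add_zero, h.init_right x hgt]
      rw [hval]
      refine (hlim h.smooth_u₀ x).congr' ?_
      filter_upwards [hφlim.eventually (gt_mem_nhds hgt)] with t ht
      exact (shock_of_le ht.le).symm

end SolvesShockSystem

/-! ### Integration by parts and smoothing of the front -/

lemma integrable_mul_of_tsupport_subset {Ω : Set (ℝ × ℝ)} {w k : ℝ × ℝ → ℝ}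
    (hw : ContinuousOn w Ω) (hk : Continuous k) (hkc : HasCompactSupport k)
    (hks : tsupport k ⊆ Ω) : Integrable fun p => w p * k p := by
  have h1 : IntegrableOn (fun p => w p * k p) (tsupport k) :=
    ((hw.mono hks).mul hk.continuousOn).integrableOn_compact hkc.isCompact
  refine (integrableOn_iff_integrable_of_support_subset fun p hp => ?_).1 h1
  by_contra hpk
  exact hp (by simp [image_eq_zero_of_notMem_tsupport hpk])

lemma integral_mul_fderiv_of_tsupport_subset {Ω : Set (ℝ × ℝ)} {w η : ℝ × ℝ → ℝ} (hΩ : IsOpen Ω)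
    (hw : ContDiffOn ℝ 1 w Ω) (hη : ContDiff ℝ ∞ η) (hηc : HasCompactSupport η)
    (hηs : tsupport η ⊆ Ω) (d : ℝ × ℝ) :
    ∫ p, w p * fderiv ℝ η p d = -∫ p, fderiv ℝ w p d * η p := by
  have hη' : Continuous fun p => fderiv ℝ η p d :=
    (hη.continuous_fderiv (by simp)).clm_apply continuous_const
  refine integral_bilinear_hasFDerivAt_right_eq_neg_left_of_integrable
    (B := ContinuousLinearMap.mul ℝ ℝ) (f' := fderiv ℝ w) (g' := fderiv ℝ η) (v := d) ?_ ?_ ?_ ?_ ?_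
  · exact integrable_mul_of_tsupport_subset
      ((hw.continuousOn_fderiv_of_isOpen hΩ le_rfl).clm_apply continuousOn_const) hη.continuous
      hηc hηs
  · exact integrable_mul_of_tsupport_subset hw.continuousOn hη' (hηc.fderiv_apply (𝕜 := ℝ) d)
      ((tsupport_fderiv_apply_subset ℝ d).trans hηs)
  · exact integrable_mul_of_tsupport_subset hw.continuousOn hη.continuous hηc hηs
  · intro p hp
    exact ((hw.contDiffAt (hΩ.mem_nhds (hηs hp))).differentiableAt (by simp)).hasFDerivAt
  · intro p _
    exact (hη.differentiable (by simp) p).hasFDerivAt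

lemma deriv_smoothTransition_of_notMem {y : ℝ} (hy : y ∉ Icc (0 : ℝ) 1) :
    deriv Real.smoothTransition y = 0 := by
  rw [mem_Icc, not_and_or, not_le, not_le] at hy
  rcases hy with hy | hy
  · have : Real.smoothTransition =ᶠ[𝓝 y] fun _ => 0 := by
      filter_upwards [gt_mem_nhds hy] with z hz
      exact Real.smoothTransition.zero_of_nonpos hz.le
    rw [this.deriv_eq, deriv_const]
  · have : Real.smoothTransition =ᶠ[𝓝 y] fun _ => 1 := by
      filter_upwards [lt_mem_nhds hy] with z hz
      exact Real.smoothTransition.one_of_one_le hz.le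
    rw [this.deriv_eq, deriv_const]

lemma exists_bound_deriv_smoothTransition :
    ∃ S, 0 ≤ S ∧ ∀ y, |deriv Real.smoothTransition y| ≤ S := by
  have hc : Continuous (deriv Real.smoothTransition) :=
    (Real.smoothTransition.contDiff (n := 1)).continuous_deriv (by simp)
  obtain ⟨S, hS⟩ := (isCompact_Icc (a := (0 : ℝ)) (b := 1)).exists_bound_of_continuousOn
    hc.continuousOn
  have hS0 : 0 ≤ S := (norm_nonneg _).trans (hS 0 (by simp))
  refine ⟨S, hS0, fun y => ?_⟩
  by_cases hy : y ∈ Icc (0 : ℝ) 1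
  · exact hS y hy
  · rwa [deriv_smoothTransition_of_notMem hy, abs_zero]

/-- A smooth cut-off that vanishes to the left of the front and equals `1` at distance at least
`1 / (n + 1)` to the right of it. -/
noncomputable def frontCutoff (φ : ℝ → ℝ) (n : ℕ) (p : ℝ × ℝ) : ℝ :=
  Real.smoothTransition ((n + 1) * (p.1 - φ p.2))

lemma frontCutoff_nonneg (n : ℕ) (p : ℝ × ℝ) : 0 ≤ frontCutoff φ n p :=
  Real.smoothTransition.nonneg _

lemma frontCutoff_le_one (n : ℕ) (p : ℝ × ℝ) : frontCutoff φ n p ≤ 1 :=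
  Real.smoothTransition.le_one _

lemma frontCutoff_of_le {n : ℕ} {p : ℝ × ℝ} (hp : p.1 ≤ φ p.2) : frontCutoff φ n p = 0 :=
  Real.smoothTransition.zero_of_nonpos
    (mul_nonpos_of_nonneg_of_nonpos (by positivity) (by linarith))

lemma eventually_one_lt_mul {y : ℝ} (hy : 0 < y) : ∀ᶠ n : ℕ in atTop, 1 < ((n : ℝ) + 1) * y := by
  obtain ⟨N, hN⟩ := exists_nat_gt (1 / y)
  filter_upwards [eventually_ge_atTop N] with n hn
  have h1 : (N : ℝ) ≤ n := by exact_mod_cast hn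
  rw [div_lt_iff₀ hy] at hN
  nlinarith

lemma eventually_frontCutoff_eq_one {p : ℝ × ℝ} (hp : φ p.2 < p.1) :
    ∀ᶠ n in atTop, frontCutoff φ n p = 1 := by
  filter_upwards [eventually_one_lt_mul (sub_pos.2 hp)] with n hn
  exact Real.smoothTransition.one_of_one_le hn.le

lemma hasFDerivAt_frontCutoff {c : ℝ} (n : ℕ) {p : ℝ × ℝ} (hφ : HasDerivAt φ c p.2) :
    HasFDerivAt (frontCutoff φ n)
      (((n + 1) * deriv Real.smoothTransition ((n + 1) * (p.1 - φ p.2))) • form 1 c) p := by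
  have h1 : HasFDerivAt (fun p : ℝ × ℝ => φ p.2) (c • ContinuousLinearMap.snd ℝ ℝ ℝ) p :=
    hφ.comp_hasFDerivAt p hasFDerivAt_snd
  have h2 : HasFDerivAt (fun p : ℝ × ℝ => ((n : ℝ) + 1) * (p.1 - φ p.2))
      (((n : ℝ) + 1) • (ContinuousLinearMap.fst ℝ ℝ ℝ - c • ContinuousLinearMap.snd ℝ ℝ ℝ)) p :=
    (hasFDerivAt_fst.sub h1).const_mul _
  have h3 := (((Real.smoothTransition.contDiff (n := 1)).differentiable (by simp))
    ((n + 1) * (p.1 - φ p.2))).hasDerivAt.comp_hasFDerivAt p h2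
  refine h3.congr_fderiv ?_
  rw [form, one_smul, smul_smul, mul_comm]

/-- The smooth transition from `B` to the left of the front to `A` to the right of it. -/
noncomputable def blend (φ : ℝ → ℝ) (n : ℕ) (A B : ℝ × ℝ → ℝ) (p : ℝ × ℝ) : ℝ :=
  frontCutoff φ n p * A p + (1 - frontCutoff φ n p) * B p

lemma abs_blend_le (n : ℕ) (A B : ℝ × ℝ → ℝ) (p : ℝ × ℝ) :
    |blend φ n A B p| ≤ |A p| + |B p| := by
  have h0 := frontCutoff_nonneg (φ := φ) n p
  have h1 := frontCutoff_le_one (φ := φ) n p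
  refine (abs_add_le _ _).trans ?_
  rw [abs_mul, abs_mul, abs_of_nonneg h0, abs_of_nonneg (sub_nonneg.2 h1)]
  nlinarith [abs_nonneg (A p), abs_nonneg (B p)]

lemma tendsto_blend {A B : ℝ × ℝ → ℝ} {p : ℝ × ℝ} {a : ℝ}
    (hA : φ p.2 < p.1 → A p = a) (hB : p.1 < φ p.2 → B p = a) (hp : p.1 ≠ φ p.2) :
    Tendsto (fun n => blend φ n A B p) atTop (𝓝 a) := by
  refine tendsto_const_nhds.congr' ?_
  rcases lt_or_gt_of_ne hp with hlt | hgt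
  · refine Eventually.of_forall fun n => ?_
    change a = blend φ n A B p
    rw [blend, frontCutoff_of_le hlt.le, hB hlt]; ring
  · filter_upwards [eventually_frontCutoff_eq_one hgt] with n hn
    rw [blend, hn, hA hgt]; ring

lemma hasFDerivAt_blend {c : ℝ} (n : ℕ) {A B : ℝ × ℝ → ℝ} {A' B' : ℝ × ℝ →L[ℝ] ℝ} {p : ℝ × ℝ}
    (hφ : HasDerivAt φ c p.2) (hA : HasFDerivAt A A' p) (hB : HasFDerivAt B B' p) :
    HasFDerivAt (blend φ n A B) (frontCutoff φ n p • A' + (1 - frontCutoff φ n p) • B' +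
      ((n + 1) * deriv Real.smoothTransition ((n + 1) * (p.1 - φ p.2)) * (A p - B p)) •
        form 1 c) p := by
  have hc := hasFDerivAt_frontCutoff n hφ
  have := (hc.mul hA).add ((hc.const_sub 1).mul hB)
  refine this.congr_fderiv ?_
  ext <;> simp <;> ring

namespace SolvesShockSystem

lemma contDiffOn_blend (h : SolvesShockSystem f T u₀₀ e₀ x₀ u₀ e φ) (n : ℕ) {A B : ℝ × ℝ → ℝ}
    (hA : ContDiffOn ℝ 1 A (strip T)) (hB : ContDiffOn ℝ 1 B (strip T)) :
    ContDiffOn ℝ 1 (blend φ n A B) (strip T) := by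
  have hφ : ContDiffOn ℝ 1 (fun p : ℝ × ℝ => φ p.2) (strip T) :=
    ((h.smooth_φ.mono Ioo_subset_Icc_self).of_le (by simp)).comp contDiff_snd.contDiffOn
      fun p hp => hp.2
  have hc : ContDiffOn ℝ 1 (frontCutoff φ n) (strip T) :=
    (Real.smoothTransition.contDiff (n := 1)).comp_contDiffOn
      (contDiffOn_const.mul (contDiff_fst.contDiffOn.sub hφ))
  exact (hc.mul hA).add ((contDiffOn_const.sub hc).mul hB)

/-- The divergence of the smoothed pair of density and flux: the transition of the residuals, plus
the derivative of the cut-off times the defect in the Rankine–Hugoniot relation. -/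
lemma divergence_blend (h : SolvesShockSystem f T u₀₀ e₀ x₀ u₀ e φ) (hf : Differentiable ℝ f)
    {A B : ℝ × ℝ → ℝ} (n : ℕ) {p : ℝ × ℝ} (hp : p ∈ strip T) (hA : DifferentiableAt ℝ A p)
    (hB : DifferentiableAt ℝ B p) :
    fderiv ℝ (blend φ n A B) p (0, 1) + fderiv ℝ (blend φ n (f ∘ A) (f ∘ B)) p (1, 0) =
      blend φ n (residual f A) (residual f B) p +
        (n + 1) * deriv Real.smoothTransition ((n + 1) * (p.1 - φ p.2)) *
          (f (A p) - f (B p) - deriv φ p.2 * (A p - B p)) := by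
  have hφ : HasDerivAt φ (deriv φ p.2) p.2 :=
    ((h.contDiffAt_front hp.2).differentiableAt (by simp)).hasDerivAt
  have h1 := hasFDerivAt_blend n hφ hA.hasFDerivAt hB.hasFDerivAt
  have h2 := hasFDerivAt_blend n hφ ((hf (A p)).hasDerivAt.comp_hasFDerivAt p hA.hasFDerivAt)
    ((hf (B p)).hasDerivAt.comp_hasFDerivAt p hB.hasFDerivAt)
  rw [h1.fderiv, h2.fderiv]
  simp [blend, residual]
  ring

/-- The defect in the Rankine–Hugoniot relation vanishes on the front, so it is bounded by the
distance from the front. This compensates the factor `n + 1` in `divergence_blend`. -/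
lemma exists_jump_defect_bound (h : SolvesShockSystem f T u₀₀ e₀ x₀ u₀ e φ)
    (hf : Differentiable ℝ f) (hf' : Continuous (deriv f)) (hpos : ∀ t ∈ Ioo 0 T, 0 < e (φ t) t)
    {K : Set (ℝ × ℝ)} (hK : IsCompact K) (hKs : K ⊆ strip T) :
    ∃ C, 0 ≤ C ∧ ∀ p ∈ K, |f (u₀ p.1 p.2) - f (u₀ p.1 p.2 + e p.1 p.2)
      - deriv φ p.2 * (u₀ p.1 p.2 - (u₀ p.1 p.2 + e p.1 p.2))| ≤ C * |p.1 - φ p.2| := by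
  set A := Function.uncurry u₀ with hA
  set B := Function.uncurry (fun x t => u₀ x t + e x t) with hB
  obtain ⟨R₁, hR₁⟩ := (hK.image continuous_fst).isBounded.subset_closedBall 0
  obtain ⟨R₂, hR₂⟩ := isCompact_Icc.exists_bound_of_continuousOn h.smooth_φ.continuousOn
  set R := max R₁ R₂
  have hK' : IsCompact (Icc (-R) R ×ˢ (Prod.snd '' K)) :=
    isCompact_Icc.prod (hK.image continuous_snd)
  have hK's : Icc (-R) R ×ˢ (Prod.snd '' K) ⊆ strip T := by
    rintro ⟨x, t⟩ ⟨-, q, hq, rfl⟩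
    exact ⟨mem_univ _, (hKs hq).2⟩
  set G : ℝ × ℝ → ℝ := fun p => deriv f (A p) * fderiv ℝ A p (1, 0)
    - deriv f (B p) * fderiv ℝ B p (1, 0)
    - deriv φ p.2 * (fderiv ℝ A p (1, 0) - fderiv ℝ B p (1, 0)) with hG
  have hGc : ContinuousOn G (strip T) := by
    intro p hp
    have a0 := h.contDiffAt_right hp
    have b0 := h.contDiffAt_left hp
    have a1 := continuousAt_fderiv_apply a0 (1, 0)
    have b1 := continuousAt_fderiv_apply b0 (1, 0)
    have c1 : ContinuousAt (fun p : ℝ × ℝ => deriv φ p.2) p := by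
      have hfd : ContinuousAt (deriv φ) p.2 := by
        have := ((h.contDiffAt_front hp.2).fderiv_right (m := 0) (by simp)).continuousAt
        have h2 := this.clm_apply (continuousAt_const (y := (1 : ℝ)))
        exact h2
      exact ContinuousAt.comp (f := Prod.snd) hfd continuous_snd.continuousAt
    have a2 := (hf'.continuousAt (x := A p)).comp a0.continuousAt
    have b2 := (hf'.continuousAt (x := B p)).comp b0.continuousAt
    exact (((a2.mul a1).sub (b2.mul b1)).sub (c1.mul (a1.sub b1))).continuousWithinAt
  obtain ⟨C, hC⟩ := hK'.exists_bound_of_continuousOn (hGc.mono hK's)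
  refine ⟨max C 0, le_max_right _ _, fun p hp => ?_⟩
  have ht := (hKs hp).2
  have hmem : ∀ y : ℝ, (y, p.2) ∈ strip T := fun y => ⟨mem_univ _, ht⟩
  have hder : ∀ y, HasDerivAt (fun y => f (A (y, p.2)) - f (B (y, p.2))
      - deriv φ p.2 * (A (y, p.2) - B (y, p.2))) (G (y, p.2)) y := by
    intro y
    have hy := (hasDerivAt_id y).prodMk (hasDerivAt_const y p.2)
    have a1 := HasFDerivAt.comp_hasDerivAt y (f := fun y : ℝ => (y, p.2))
      ((h.contDiffAt_right (hmem y)).differentiableAt (by simp)).hasFDerivAt hy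
    have b1 := HasFDerivAt.comp_hasDerivAt y (f := fun y : ℝ => (y, p.2))
      ((h.contDiffAt_left (hmem y)).differentiableAt (by simp)).hasFDerivAt hy
    exact (((hf (A (y, p.2))).hasDerivAt.comp y a1).sub
      ((hf (B (y, p.2))).hasDerivAt.comp y b1)).sub ((a1.sub b1).const_mul (deriv φ p.2))
  have hbound := (convex_Icc (-R) R).norm_image_sub_le_of_norm_hasDerivWithin_le (C := max C 0)
    (fun y _ => (hder y).hasDerivWithinAt)
    (fun y hy => (hC (y, p.2) ⟨hy, p, hp, rfl⟩).trans (le_max_left _ _))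
    (x := φ p.2) (y := p.1)
    (abs_le.1 ((hR₂ p.2 (Ioo_subset_Icc_self ht)).trans (le_max_right _ _)))
    (abs_le.1 (by
      have := hR₁ (mem_image_of_mem Prod.fst hp)
      rw [mem_closedBall_zero_iff, Real.norm_eq_abs] at this
      exact this.trans (le_max_left _ _)))
  have hzero : f (A (φ p.2, p.2)) - f (B (φ p.2, p.2))
      - deriv φ p.2 * (A (φ p.2, p.2) - B (φ p.2, p.2)) = 0 := by
    have := h.front_eq p.2 ht
    rw [eq_div_iff (hpos _ ht).ne'] at this
    simp only [hA, hB, Function.uncurry]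
    linarith
  rw [hzero, sub_zero] at hbound
  exact hbound

/-- The smoothed shocks satisfy the identity up to the integral of their divergence, which is
bounded and tends to zero off the front. -/
lemma integralIdentity (h : SolvesShockSystem f T u₀₀ e₀ x₀ u₀ e φ) (hT : 0 < T)
    (hf : ContDiff ℝ ∞ f) (hpos : ∀ t ∈ Ioo 0 T, 0 < e (φ t) t) :
    IntegralIdentity f (strip T) (shock u₀ e φ) := by
  intro η₀ hη hηc hηs
  set η := Function.uncurry η₀ with hηdef
  have hfd : Differentiable ℝ f := hf.differentiable (by simp)
  have hf' : Continuous (deriv f) := hf.continuous_deriv (by simp)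
  set A := Function.uncurry u₀ with hA
  set B := Function.uncurry (fun x t => u₀ x t + e x t) with hB
  have hAs : ContDiffOn ℝ 1 A (strip T) := fun p hp =>
    ((h.contDiffAt_right hp).of_le (by simp)).contDiffWithinAt
  have hBs : ContDiffOn ℝ 1 B (strip T) := fun p hp =>
    ((h.contDiffAt_left hp).of_le (by simp)).contDiffWithinAt
  have hfAs : ContDiffOn ℝ 1 (f ∘ A) (strip T) := (hf.of_le (by simp)).comp_contDiffOn hAs
  have hfBs : ContDiffOn ℝ 1 (f ∘ B) (strip T) := (hf.of_le (by simp)).comp_contDiffOn hBs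
  have hkc : ∀ d, Continuous fun p => fderiv ℝ η p d := fun d =>
    (hη.continuous_fderiv (by simp)).clm_apply continuous_const
  have hkk : ∀ d, HasCompactSupport fun p => fderiv ℝ η p d := fun d =>
    hηc.fderiv_apply (𝕜 := ℝ) d
  have hks : ∀ d, tsupport (fun p => fderiv ℝ η p d) ⊆ strip T := fun d =>
    (tsupport_fderiv_apply_subset ℝ d).trans hηs
  have hkz : ∀ d, ∀ p ∉ strip T, fderiv ℝ η p d = 0 := fun d p hp =>
    image_eq_zero_of_notMem_tsupport (f := fun p => fderiv ℝ η p d) fun hp' => hp (hks d hp')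
  have hηz : ∀ p ∉ strip T, η p = 0 := fun p hp =>
    image_eq_zero_of_notMem_tsupport fun hp' => hp (hηs hp')
  have hoff : ∀ᵐ p : ℝ × ℝ, p ∈ strip T → p.1 ≠ φ p.2 := by
    filter_upwards [ae_fst_ne_of_continuousOn hT.le h.smooth_φ.continuousOn] with p hp hps
    exact hp (Ioo_subset_Icc_self hps.2)
  -- integration by parts for the smoothed shock
  have hibp : ∀ n, ∫ p, (blend φ n A B p * fderiv ℝ η p (0, 1)
      + blend φ n (f ∘ A) (f ∘ B) p * fderiv ℝ η p (1, 0)) =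
      -∫ p, (fderiv ℝ (blend φ n A B) p (0, 1) + fderiv ℝ (blend φ n (f ∘ A) (f ∘ B)) p (1, 0))
        * η p := by
    intro n
    have c1 := h.contDiffOn_blend n hAs hBs
    have c2 := h.contDiffOn_blend n hfAs hfBs
    simp_rw [add_mul]
    rw [integral_add
      (integrable_mul_of_tsupport_subset c1.continuousOn (hkc _) (hkk _) (hks _))
      (integrable_mul_of_tsupport_subset c2.continuousOn (hkc _) (hkk _) (hks _)),
      integral_add
      (integrable_mul_of_tsupport_subset
        ((c1.continuousOn_fderiv_of_isOpen (isOpen_strip T) le_rfl).clm_apply continuousOn_const)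
        hη.continuous hηc hηs)
      (integrable_mul_of_tsupport_subset
        ((c2.continuousOn_fderiv_of_isOpen (isOpen_strip T) le_rfl).clm_apply continuousOn_const)
        hη.continuous hηc hηs),
      integral_mul_fderiv_of_tsupport_subset (isOpen_strip T) c1 hη hηc hηs,
      integral_mul_fderiv_of_tsupport_subset (isOpen_strip T) c2 hη hηc hηs, neg_add]
  have hleft : Tendsto (fun n => ∫ p, (blend φ n A B p * fderiv ℝ η p (0, 1)
      + blend φ n (f ∘ A) (f ∘ B) p * fderiv ℝ η p (1, 0))) atTop
      (𝓝 (∫ p : ℝ × ℝ, (shock u₀ e φ p.1 p.2 * fderiv ℝ η p (0, 1)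
        + f (shock u₀ e φ p.1 p.2) * fderiv ℝ η p (1, 0)))) := by
    refine tendsto_integral_of_dominated_convergence
      (fun p => |(|A p| + |B p|) * fderiv ℝ η p (0, 1)|
        + |(|(f ∘ A) p| + |(f ∘ B) p|) * fderiv ℝ η p (1, 0)|) ?_ ?_ ?_ ?_
    · intro n
      exact ((integrable_mul_of_tsupport_subset (h.contDiffOn_blend n hAs hBs).continuousOn
        (hkc _) (hkk _) (hks _)).add (integrable_mul_of_tsupport_subset
        (h.contDiffOn_blend n hfAs hfBs).continuousOn (hkc _) (hkk _)
        (hks _))).aestronglyMeasurable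
    · exact (integrable_mul_of_tsupport_subset (hAs.continuousOn.abs.add hBs.continuousOn.abs)
        (hkc _) (hkk _) (hks _)).abs.add (integrable_mul_of_tsupport_subset
        (hfAs.continuousOn.abs.add hfBs.continuousOn.abs) (hkc _) (hkk _) (hks _)).abs
    · intro n
      refine Eventually.of_forall fun p => (abs_add_le _ _).trans (add_le_add ?_ ?_)
      all_goals
        rw [abs_mul, abs_mul]
        refine mul_le_mul_of_nonneg_right ?_ (abs_nonneg _)
        exact (abs_blend_le n _ _ p).trans (le_abs_self _)
    · filter_upwards [hoff] with p hp
      by_cases hps : p ∈ strip T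
      · refine (Tendsto.mul_const _ ?_).add (Tendsto.mul_const _ ?_)
        · exact tendsto_blend (fun hlt => (shock_of_le hlt.le).symm)
            (fun hlt => (shock_of_lt hlt).symm) (hp hps)
        · exact tendsto_blend (fun hlt => congrArg f (shock_of_le hlt.le).symm)
            (fun hlt => congrArg f (shock_of_lt hlt).symm) (hp hps)
      · simp [hkz _ p hps]
  have hright : Tendsto (fun n => ∫ p, (fderiv ℝ (blend φ n A B) p (0, 1)
      + fderiv ℝ (blend φ n (f ∘ A) (f ∘ B)) p (1, 0)) * η p) atTop (𝓝 0) := by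
    obtain ⟨S, hS0, hS⟩ := exists_bound_deriv_smoothTransition
    obtain ⟨C, hC0, hC⟩ := h.exists_jump_defect_bound hfd hf' hpos hηc.isCompact hηs
    have hdiv : ∀ n, ∀ p ∈ strip T, fderiv ℝ (blend φ n A B) p (0, 1)
        + fderiv ℝ (blend φ n (f ∘ A) (f ∘ B)) p (1, 0) = _ := fun n p hp =>
      h.divergence_blend hfd n hp ((h.contDiffAt_right hp).differentiableAt (by simp))
        ((h.contDiffAt_left hp).differentiableAt (by simp))
    have hrA : ContinuousOn (residual f A) (strip T) := fun p hp =>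
      (continuousAt_residual hf' (h.contDiffAt_right hp)).continuousWithinAt
    have hrB : ContinuousOn (residual f B) (strip T) := fun p hp =>
      (continuousAt_residual hf' (h.contDiffAt_left hp)).continuousWithinAt
    suffices Tendsto (fun n => ∫ p, (fderiv ℝ (blend φ n A B) p (0, 1)
        + fderiv ℝ (blend φ n (f ∘ A) (f ∘ B)) p (1, 0)) * η p) atTop
        (𝓝 (∫ _ : ℝ × ℝ, (0 : ℝ))) by simpa using this
    refine tendsto_integral_of_dominated_convergence
      (fun p => |(|residual f A p| + |residual f B p| + S * C) * η p|) ?_ ?_ ?_ ?_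
    · intro n
      exact (integrable_mul_of_tsupport_subset
        ((((h.contDiffOn_blend n hAs hBs).continuousOn_fderiv_of_isOpen (isOpen_strip T)
          le_rfl).clm_apply continuousOn_const).add
        (((h.contDiffOn_blend n hfAs hfBs).continuousOn_fderiv_of_isOpen (isOpen_strip T)
          le_rfl).clm_apply continuousOn_const)) hη.continuous hηc hηs).aestronglyMeasurable
    · exact (integrable_mul_of_tsupport_subset
        ((hrA.abs.add hrB.abs).add continuousOn_const) hη.continuous hηc hηs).abs
    · intro n
      refine Eventually.of_forall fun p => ?_
      by_cases hp : p ∈ tsupport η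
      · rw [hdiv n p (hηs hp), Real.norm_eq_abs, abs_mul, abs_mul]
        refine mul_le_mul_of_nonneg_right (le_trans ?_ (le_abs_self _)) (abs_nonneg _)
        refine (abs_add_le _ _).trans (add_le_add (abs_blend_le n _ _ p) ?_)
        have hn : (0 : ℝ) < n + 1 := by positivity
        rw [abs_mul, abs_mul, abs_of_pos hn]
        by_cases hy : ((n : ℝ) + 1) * (p.1 - φ p.2) ∈ Icc (0 : ℝ) 1
        · calc _ ≤ (n + 1) * S * (C * |p.1 - φ p.2|) := by
                gcongr
                · exact hS _
                · exact hC p hp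
            _ = S * C * |((n : ℝ) + 1) * (p.1 - φ p.2)| := by
                rw [abs_mul, abs_of_pos hn]; ring
            _ ≤ S * C * 1 := by
                gcongr
                rw [abs_of_nonneg hy.1]; exact hy.2
            _ = S * C := mul_one _
        · rw [deriv_smoothTransition_of_notMem hy, abs_zero, mul_zero, zero_mul]
          positivity
      · simp [image_eq_zero_of_notMem_tsupport hp]
    · filter_upwards [hoff] with p hp
      by_cases hps : p ∈ strip T
      · suffices Tendsto (fun n => fderiv ℝ (blend φ n A B) p (0, 1)
            + fderiv ℝ (blend φ n (f ∘ A) (f ∘ B)) p (1, 0)) atTop (𝓝 (0 + 0)) by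
          have := this.mul_const (η p)
          rwa [add_zero, zero_mul] at this
        simp_rw [hdiv _ p hps]
        refine (tendsto_blend (fun hlt => h.residual_right hfd hps hlt)
          (fun hlt => h.residual_left hfd hps hlt) (hp hps)).add ?_
        refine tendsto_const_nhds.congr' ?_
        have hy : ∀ᶠ n : ℕ in atTop, ((n : ℝ) + 1) * (p.1 - φ p.2) ∉ Icc (0 : ℝ) 1 := by
          rcases lt_or_gt_of_ne (hp hps) with hlt | hgt
          · refine Eventually.of_forall fun n hn => ?_
            have : ((n : ℝ) + 1) * (p.1 - φ p.2) < 0 :=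
              mul_neg_of_pos_of_neg (by positivity) (by linarith)
            linarith [hn.1]
          · filter_upwards [eventually_one_lt_mul (sub_pos.2 hgt)] with n hn hmem
            linarith [hmem.2]
        filter_upwards [hy] with n hn
        rw [deriv_smoothTransition_of_notMem hn, mul_zero, zero_mul]
      · simp [hηz p hps]
  have hlim : ∫ p : ℝ × ℝ, (shock u₀ e φ p.1 p.2 * fderiv ℝ η p (0, 1)
        + f (shock u₀ e φ p.1 p.2) * fderiv ℝ η p (1, 0)) = 0 := by
    refine tendsto_nhds_unique hleft ?_
    simp_rw [hibp]
    simpa using hright.neg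
  have hpt : ∀ p : ℝ × ℝ, shock u₀ e φ p.1 p.2 * deriv (fun s => η₀ p.1 s) p.2
      + f (shock u₀ e φ p.1 p.2) * deriv (fun y => η₀ y p.2) p.1 =
      shock u₀ e φ p.1 p.2 * fderiv ℝ η p (0, 1)
        + f (shock u₀ e φ p.1 p.2) * fderiv ℝ η p (1, 0) := by
    intro p
    have hd := (hη.differentiable (by simp) p).hasFDerivAt
    have d1 : HasDerivAt (fun s => η₀ p.1 s) (fderiv ℝ η p (0, 1)) p.2 :=
      HasFDerivAt.comp_hasDerivAt p.2 (f := fun s : ℝ => (p.1, s)) hd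
        ((hasDerivAt_const _ _).prodMk (hasDerivAt_id _))
    have d2 : HasDerivAt (fun y => η₀ y p.2) (fderiv ℝ η p (1, 0)) p.1 :=
      HasFDerivAt.comp_hasDerivAt p.1 (f := fun y : ℝ => (y, p.2)) hd
        ((hasDerivAt_id _).prodMk (hasDerivAt_const _ _))
    rw [d1.deriv, d2.deriv]
  simp_rw [hpt]
  refine (setIntegral_eq_integral_of_forall_compl_eq_zero fun p hp => ?_).trans hlim
  rw [hkz _ p hp, hkz _ p hp, mul_zero, mul_zero, add_zero]

lemma isGeneralizedSolution (h : SolvesShockSystem f T u₀₀ e₀ x₀ u₀ e φ) (hT : 0 < T)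
    (hf : ContDiff ℝ ∞ f) (hpos : ∀ t ∈ Ioo 0 T, 0 < e (φ t) t) :
    IsGeneralizedSolution f T (initialStep u₀₀ e₀ x₀) (shock u₀ e φ) where
  aestronglyMeasurable := h.aestronglyMeasurable
  locallyBounded K hK hKs := by
    obtain ⟨M, hM⟩ := h.locallyBounded hK (hKs.trans (prod_mono le_rfl Ico_subset_Icc_self))
    exact ⟨M, Eventually.of_forall hM⟩
  integralIdentity := h.integralIdentity hT hf hpos
  initialValue _ hψ hψc := h.initialValue hT hψ.continuous hψc

end SolvesShockSystem

end Front

end ShockWave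

theorem mainTheorem6
    (f : ℝ → ℝ) (hf : ContDiff ℝ ∞ f) (hconv : ∀ s, 0 ≤ deriv (deriv f) s)
    (u₀₀ e₀ : ℝ → ℝ) (hu₀₀ : ContDiff ℝ ∞ u₀₀) (he₀ : ContDiff ℝ ∞ e₀) (he₀_pos : ∀ x, 0 < e₀ x)
    (x₀ T : ℝ) (hT : 0 < T)
    (hT_right : -(⨅ ξ ∈ Set.Ioi x₀, ((deriv u₀₀ ξ * deriv (deriv f) (u₀₀ ξ) : ℝ) : EReal))
      < ((T⁻¹ : ℝ) : EReal))
    (hT_left : -(⨅ ξ ∈ Set.Iio x₀,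
        ((deriv (fun y => u₀₀ y + e₀ y) ξ * deriv (deriv f) (u₀₀ ξ + e₀ ξ) : ℝ) : EReal))
      < ((T⁻¹ : ℝ) : EReal))
    (u₀ e : ℝ → ℝ → ℝ) (φ : ℝ → ℝ)
    (hsys : ShockWave.SolvesShockSystem f T u₀₀ e₀ x₀ u₀ e φ) :
    (ShockWave.IsGeneralizedSolution f T (ShockWave.initialStep u₀₀ e₀ x₀)
        (ShockWave.shock u₀ e φ) ∧
      ShockWave.IsPiecewiseSmooth T (ShockWave.shock u₀ e φ) ∧
      ShockWave.IsStable T (ShockWave.shock u₀ e φ)) ∧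
    ∀ v : ℝ → ℝ → ℝ,
      ShockWave.IsGeneralizedSolution f T (ShockWave.initialStep u₀₀ e₀ x₀) v →
      ShockWave.IsPiecewiseSmooth T v → ShockWave.IsStable T v →
      Function.uncurry v =ᵐ[MeasureTheory.volume.restrict (ShockWave.strip T)]
        Function.uncurry (ShockWave.shock u₀ e φ) := by
  have hmono : Monotone (deriv f) :=
    monotone_of_deriv_nonneg ((hf.iterate_deriv 1).differentiable (by simp)) hconv
  have hpos : ∀ t ∈ Set.Ioo 0 T, 0 < e (φ t) t := fun t ht =>
    hsys.front_pos hf hmono hu₀₀.continuous he₀.continuous he₀_pos ht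
  have hsol := hsys.isGeneralizedSolution hT hf hpos
  have hps := hsys.isPiecewiseSmooth
  have hst := hsys.isStable hpos
  exact ⟨⟨hsol, hps, hst⟩, fun v hv hvs hvst => ShockWave.ae_eq_of_stable hT
    (hf.differentiable (by simp)) (hf.continuous_deriv (by simp)) hmono hv hvs hvst hsol hps hst⟩
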